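/- Let $\mathcal G$ be the group of finite sets of nonnegative integers under symmetric difference (so that $\emptyset$ is the neutral element), and let $\mathbf C[\mathcal G]$ be its group algebra with the trace $\psi(\sum_A x_A A)=x_\emptyset$. For integers $r,n\ge 1$ and $t\in[0,+\infty)$ put $$L_r(n,t)=\frac1{n^{r/2}}\sum_{(a_1,\dots,a_r)}\{a_1,\dots,a_r\}\in\mathbf C[\mathcal G],$$ where the sum runs over all $r$-tuples of pairwise distinct integers of $[1,nt]$. Let $(H_r)_{r\ge 0}$ be the Hermite polynomials, given by $H_0(x)=1$, $H_1(x)=x$ and $xH_r(x)=H_{r+1}(x)+rH_{r-1}(x)$ for $r\ge1$. Theorem. There are a probability space $(\Omega,\mathbf P)$ and a family $(L_r(t))_{r\ge1,\,t\in[0,+\infty)}$ of real random variables on it, having moments of all orders, such that 1. $(L_1(t))_{t\in[0,+\infty)}$ is a classical (standard, real) Brownian motion; 2. $L_r(t)=t^{r/2}H_r\bigl(t^{-1/2}L_1(t)\bigr)$ for all $r\ge1$ and $t>0$, and $L_r(0)=0$ for all $r\ge1$; 3. as $n\to\infty$, the distribution of the family $(L_r(n,t))_{r\ge1,\,t\in[0,+\infty)}$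 in $(\mathbf C[\mathcal G],\psi)$ converges to that of $(L_r(t))_{r\ge1,\,t\in[0,+\infty)}$, that is, for every polynomial $Q$ with complex coefficients in non commutative variables $(X_{r,t})_{r\ge1,\,t\in[0,+\infty)}$, $$\lim_{n\to\infty}\psi\bigl(Q((L_r(n,t))_{r,t})\bigr)=\mathbf E\bigl[Q((L_r(t))_{r,t})\bigr].$$ -/

import Mathlib

open MeasureTheory ProbabilityTheory Filter Topology
open scoped NNReal

/-- The set of finite sets of nonnegative integers, which carries below the (multiplicatively
written) group law given by the symmetric difference. -/
def FinsetGroup : Type := Finset ℕ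

/-- A finite set of nonnegative integers, seen as a group element. -/
def FinsetGroup.mk (A : Finset ℕ) : FinsetGroup := A

/-- The group of finite sets of nonnegative integers: the product is the symmetric difference,
the neutral element is the empty set and every element is its own inverse. -/
instance FinsetGroup.instCommGroup : CommGroup FinsetGroup where
  mul A B := FinsetGroup.mk (symmDiff (α := Finset ℕ) A B)
  mul_assoc A B C := symmDiff_assoc (α := Finset ℕ) A B C
  one := FinsetGroup.mk ∅
  one_mul A := bot_symmDiff (α := Finset ℕ) A
  mul_one A := symmDiff_bot (α := Finset ℕ) A
  inv A := A
  inv_mul_cancel A := symmDiff_self (α := Finset ℕ) A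
  mul_comm A B := symmDiff_comm (α := Finset ℕ) A B

theorem FinsetGroup.mk_mul (A B : Finset ℕ) :
    FinsetGroup.mk A * FinsetGroup.mk B = FinsetGroup.mk (symmDiff A B) := rfl

theorem FinsetGroup.mk_empty : FinsetGroup.mk ∅ = 1 := rfl

/-- The canonical trace on the group algebra `ℂ[G]`: the coefficient of the neutral element. -/
def canonicalTrace (G : Type*) [Group G] : MonoidAlgebra ℂ G →ₗ[ℂ] ℂ where
  toFun x := x.coeff 1
  map_add' x y := by simp
  map_smul' c x := by simp

/-- The (non commutative) distribution of a family `x` of elements of a complex unital algebra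
endowed with a linear form `φ`: it maps a polynomial `p` in the non commutative variables
`(X i)` to `φ (p (x))`. -/
noncomputable def ncDistribution {ι A : Type*} [Ring A] [Algebra ℂ A] (φ : A →ₗ[ℂ] ℂ)
    (x : ι → A) (p : FreeAlgebra ℂ ι) : ℂ :=
  φ (FreeAlgebra.lift ℂ x p)

/-- The random variable `p (X)`, for a family `X` of real random variables and a polynomial `p`
with complex coefficients in (non commutative) variables. -/
noncomputable def polyRandomVariable {ι Ω : Type*} (X : ι → Ω → ℝ) (p : FreeAlgebra ℂ ι)
    (ω : Ω) : ℂ :=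
  FreeAlgebra.lift ℂ (fun i => (X i ω : ℂ)) p

/-- The distribution of a commutative family of real random variables: it maps a polynomial `p`
to the expectation of `p (X)`. -/
noncomputable def classicalDistribution {ι Ω : Type*} [MeasurableSpace Ω] (P : Measure Ω)
    (X : ι → Ω → ℝ) (p : FreeAlgebra ℂ ι) : ℂ :=
  ∫ ω, polyRandomVariable X p ω ∂P

/-- The `r`-tuples `(a₁, …, a_r)` of pairwise distinct integers of `[1, n t]`. -/
noncomputable def distinctTuples (r n : ℕ) (t : ℝ≥0) : Finset (Fin r → ℕ) :=
  {a ∈ Fintype.piFinset fun _ : Fin r => Finset.Icc 1 ⌊(n : ℝ) * (t : ℝ)⌋₊ |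
    Function.Injective a}

theorem mem_distinctTuples {r n : ℕ} {t : ℝ≥0} {a : Fin r → ℕ} :
    a ∈ distinctTuples r n t ↔
      (∀ i, 1 ≤ a i ∧ (a i : ℝ) ≤ (n : ℝ) * (t : ℝ)) ∧ Function.Injective a := by
  have h : (0 : ℝ) ≤ (n : ℝ) * (t : ℝ) := by positivity
  simp [distinctTuples, Nat.le_floor_iff h]

/-- The element `L_r(n, t) = n ^ (-r/2) ∑ {a₁, …, a_r}` of the group algebra, the sum running over
the `r`-tuples of pairwise distinct integers of `[1, n t]`. -/
noncomputable def setSum (r n : ℕ) (t : ℝ≥0) : MonoidAlgebra ℂ FinsetGroup :=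
  (((n : ℝ) ^ (-(r : ℝ) / 2) : ℝ) : ℂ) •
    ∑ a ∈ distinctTuples r n t,
      MonoidAlgebra.of ℂ FinsetGroup (FinsetGroup.mk (Finset.univ.image a))

/-- The quantity `t ^ (r/2) H_r (t ^ (-1/2) x)`, where `H_r` is the `r`-th (probabilists') Hermite
polynomial. For `t = 0` and `r ≥ 1` it equals `0`. -/
noncomputable def scaledHermite (r : ℕ) (t : ℝ≥0) (x : ℝ) : ℝ :=
  (t : ℝ) ^ ((r : ℝ) / 2) *
    Polynomial.aeval ((t : ℝ) ^ (-(1 / 2) : ℝ) * x) (Polynomial.hermite r)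

theorem scaledHermite_zero {r : ℕ} (hr : 1 ≤ r) (x : ℝ) : scaledHermite r 0 x = 0 := by
  have h : (r : ℝ) / 2 ≠ 0 := by positivity
  simp [scaledHermite, Real.zero_rpow h]

/-!
Subsets of disjoint sets of integers generate subgroups with trivial intersection, so that the trace
makes the increments of `L_1(n, ·)` independent, and each of them behaves like a normalized sum of
signs. Since singletons are involutions, their elementary symmetric polynomials satisfy
`e₁ e_{r+1} = (r + 2) e_{r+2} + (N - r) e_r`. Therefore `L_r(n, t)` is obtained from `L_1(n, t)` by
evaluating a polynomial given by a three-term recursion (a Krawtchouk polynomial), and the trace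
kills the non constant ones. The coefficients `(r + 1) (N - r) / n` of the recursion for
`N = ⌊n t⌋` tend to the coefficients `(r + 1) t` of the recursion for scaled Hermite polynomials,
which the Gaussian law of variance `t` kills likewise. Both the polynomials and the functional
that kills the non constant ones depend continuously on these coefficients.

The limit is Lévy's construction of Brownian motion from Schauder functions, which vanishes at time
`0` for every sample, as needed for the relation between `L_r` and `L_1` to hold everywhere.
-/

section TestTendsto

variable {α ι 𝕜 A : Type*} [CommRing 𝕜] [TopologicalSpace 𝕜] {l : Filter α}

/-- Convergence tested against all pointwise convergent families of linear forms. For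
sequences of complex polynomials it means coefficientwise convergence with bounded degrees. -/
def TestTendsto (𝕜 : Type*) [CommRing 𝕜] [TopologicalSpace 𝕜] [AddCommGroup A] [Module 𝕜 A]
    (x : α → A) (l : Filter α) (x₀ : A) : Prop :=
  ∀ (φ : α → A →ₗ[𝕜] 𝕜) (φ₀ : A →ₗ[𝕜] 𝕜), (∀ a, Tendsto (fun i => φ i a) l (𝓝 (φ₀ a))) →
    Tendsto (fun i => φ i (x i)) l (𝓝 (φ₀ x₀))

section Module

variable [AddCommGroup A] [Module 𝕜 A] {x y : α → A} {x₀ y₀ : A}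

theorem testTendsto_const (a : A) : TestTendsto 𝕜 (fun _ : α => a) l a := fun _ _ h => h a

theorem TestTendsto.add [ContinuousAdd 𝕜] (hx : TestTendsto 𝕜 x l x₀)
    (hy : TestTendsto 𝕜 y l y₀) : TestTendsto 𝕜 (fun i => x i + y i) l (x₀ + y₀) :=
  fun φ φ₀ h => by simpa only [map_add] using (hx φ φ₀ h).add (hy φ φ₀ h)

theorem TestTendsto.sub [ContinuousSub 𝕜] (hx : TestTendsto 𝕜 x l x₀)
    (hy : TestTendsto 𝕜 y l y₀) : TestTendsto 𝕜 (fun i => x i - y i) l (x₀ - y₀) :=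
  fun φ φ₀ h => by simpa only [map_sub] using (hx φ φ₀ h).sub (hy φ φ₀ h)

theorem TestTendsto.smul [ContinuousMul 𝕜] {c : α → 𝕜} {c₀ : 𝕜} (hc : Tendsto c l (𝓝 c₀))
    (hx : TestTendsto 𝕜 x l x₀) : TestTendsto 𝕜 (fun i => c i • x i) l (c₀ • x₀) :=
  fun φ φ₀ h => by simpa only [map_smul, smul_eq_mul] using hc.mul (hx φ φ₀ h)

theorem TestTendsto.map {B : Type*} [AddCommGroup B] [Module 𝕜 B] (g : A →ₗ[𝕜] B)
    (hx : TestTendsto 𝕜 x l x₀) : TestTendsto 𝕜 (fun i => g (x i)) l (g x₀) := fun φ φ₀ h =>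
  hx (fun i => φ i ∘ₗ g) (φ₀ ∘ₗ g) fun a => h (g a)

end Module

section Algebra

variable [Ring A] [Algebra 𝕜 A]

theorem TestTendsto.mul {x y : α → A} {x₀ y₀ : A} (hx : TestTendsto 𝕜 x l x₀)
    (hy : TestTendsto 𝕜 y l y₀) : TestTendsto 𝕜 (fun i => x i * y i) l (x₀ * y₀) := fun φ φ₀ h =>
  hy (fun i => φ i ∘ₗ LinearMap.mulLeft 𝕜 (x i)) (φ₀ ∘ₗ LinearMap.mulLeft 𝕜 x₀) fun b =>
    hx (fun i => φ i ∘ₗ LinearMap.mulRight 𝕜 b) (φ₀ ∘ₗ LinearMap.mulRight 𝕜 b) fun a => h (a * b)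

theorem TestTendsto.freeAlgebraLift [ContinuousAdd 𝕜] {x : α → ι → A} {x₀ : ι → A}
    (hx : ∀ j, TestTendsto 𝕜 (fun i => x i j) l (x₀ j)) (p : FreeAlgebra 𝕜 ι) :
    TestTendsto 𝕜 (fun i => FreeAlgebra.lift 𝕜 (x i) p) l (FreeAlgebra.lift 𝕜 x₀ p) := by
  induction p using FreeAlgebra.induction with
  | grade0 c => simpa only [AlgHom.commutes] using testTendsto_const _
  | grade1 j => simpa only [FreeAlgebra.lift_ι_apply] using hx j
  | mul p q hp hq => simpa only [map_mul] using hp.mul hq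
  | add p q hp hq => simpa only [map_add] using hp.add hq

end Algebra

end TestTendsto

theorem map_freeAlgebraLift {ι R B C : Type*} [CommSemiring R] [Semiring B] [Algebra R B]
    [Semiring C] [Algebra R C] (g : B →ₐ[R] C) (x : ι → B) (p : FreeAlgebra R ι) :
    g (FreeAlgebra.lift R x p) = FreeAlgebra.lift R (fun j => g (x j)) p :=
  DFunLike.congr_fun ((FreeAlgebra.lift_unique _ (g.comp (FreeAlgebra.lift R x))).1
    (funext fun j => congrArg g (FreeAlgebra.lift_ι_apply x j))) p

section Esymm

variable {R : Type*} [CommRing R]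

theorem esymm_zero (s : Multiset R) : s.esymm 0 = 1 := by
  simp [Multiset.esymm]

theorem esymm_one (s : Multiset R) : s.esymm 1 = s.sum := by
  simp [Multiset.esymm, Multiset.powersetCard_one]

theorem esymm_cons_succ (a : R) (s : Multiset R) (r : ℕ) :
    (a ::ₘ s).esymm (r + 1) = s.esymm (r + 1) + a * s.esymm r := by
  simp [Multiset.esymm, Multiset.sum_map_mul_left]

theorem sum_mul_esymm_succ {c : R} {s : Multiset R} (hs : ∀ y ∈ s, y ^ 2 = c) (r : ℕ) :
    s.sum * s.esymm (r + 1) =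
      (r + 2) * s.esymm (r + 2) + c * (s.card - r) * s.esymm r := by
  induction s using Multiset.induction generalizing r with
  | empty => cases r <;> simp [Multiset.esymm, Multiset.powersetCard_zero_right]
  | cons a s ih =>
    have ha : a ^ 2 = c := hs a (Multiset.mem_cons_self a s)
    replace ih := ih fun y hy => hs y (Multiset.mem_cons_of_mem hy)
    rw [esymm_cons_succ, esymm_cons_succ, Multiset.sum_cons, Multiset.card_cons]
    cases r with
    | zero =>
      have h := ih 0
      simp only [zero_add, esymm_zero, esymm_one, Nat.cast_zero, Nat.cast_succ] at h ⊢
      linear_combination h + ha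
    | succ r =>
      rw [esymm_cons_succ]
      have h := ih r
      have h' := ih (r + 1)
      push_cast at h' ⊢
      linear_combination a * h + h' + s.esymm (r + 1) * ha

end Esymm

section ThreeTermRecursion

open Polynomial

variable {R S : Type*} [CommRing R] [CommRing S]

/-- The monic polynomials with `p₀ = 1`, `p₁ = X` and `p_{r+2} = X p_{r+1} - c_r p_r`, orthogonal
for a symmetric functional with Jacobi coefficients `c`. Here `c r` multiplies `p r`, so that it is
the `(r + 1)`-st coefficient in the usual numbering. -/
noncomputable def threeTermPoly (c : ℕ → R) : ℕ → R[X]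
  | 0 => 1
  | 1 => X
  | r + 2 => X * threeTermPoly c (r + 1) - C (c r) * threeTermPoly c r

theorem aeval_threeTermPoly_of_recursion [Algebra R S] {c : ℕ → R} {d : ℕ → S} (h0 : d 0 = 1)
    (hd : ∀ r, d (r + 2) = d 1 * d (r + 1) - c r • d r) (r : ℕ) :
    aeval (d 1) (threeTermPoly c r) = d r := by
  induction r using Nat.twoStepInduction with
  | zero => simp only [threeTermPoly, map_one, h0]
  | one => simp only [threeTermPoly, aeval_X]
  | more r ih ih' =>
    simp only [threeTermPoly, map_sub, map_mul, aeval_X, aeval_C, ih, ih', hd,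
      Algebra.smul_def]

theorem aeval_threeTermPoly_eq_esymm [Algebra R S] {s : Multiset S} (hs : ∀ y ∈ s, y ^ 2 = 1)
    (b : R) (r : ℕ) :
    aeval (b • s.sum) (threeTermPoly (fun r => (r + 1) * (s.card - r) * b ^ 2) r) =
      (b ^ r * r.factorial) • s.esymm r := by
  have hrec (r : ℕ) : (b ^ (r + 2) * (r + 2).factorial) • s.esymm (r + 2) =
      (b ^ 1 * (1 : ℕ).factorial) • s.esymm 1 *
          (b ^ (r + 1) * (r + 1).factorial) • s.esymm (r + 1) -
        ((r + 1) * (s.card - r) * b ^ 2) • (b ^ r * r.factorial) • s.esymm r := by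
    have h := sum_mul_esymm_succ hs r
    simp only [esymm_one, Nat.factorial, Algebra.smul_def, map_mul, map_pow, map_natCast,
      map_sub, map_add, map_one, Nat.cast_mul, Nat.cast_succ]
    linear_combination (-algebraMap R S b ^ (r + 2) * (r + 1) * r.factorial) * h
  simpa only [pow_one, Nat.factorial_one, Nat.cast_one, mul_one, esymm_one] using
    aeval_threeTermPoly_of_recursion (c := fun r : ℕ => (r + 1) * (s.card - r) * b ^ 2)
      (d := fun r => (b ^ r * r.factorial) • s.esymm r) (by simp [esymm_zero]) hrec r

theorem derivative_threeTermPoly (v : R) (r : ℕ) :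
    derivative (threeTermPoly (fun r => (r + 1) * v) (r + 1)) =
      (r + 1) * threeTermPoly (fun r => (r + 1) * v) r := by
  induction r using Nat.twoStepInduction with
  | zero => simp [threeTermPoly]
  | one =>
    simp only [threeTermPoly, Nat.cast_zero, zero_add, one_mul, mul_one, derivative_sub,
      derivative_mul, derivative_X, derivative_C, sub_zero, Nat.cast_one]
    ring
  | more r ih ih' =>
    rw [threeTermPoly, derivative_sub, derivative_mul, derivative_X, derivative_C_mul, ih, ih']
    simp only [threeTermPoly, map_mul, map_add, map_natCast, map_one]
    push_cast
    ring

theorem threeTermPoly_succ_eq_sub_derivative (v : R) (r : ℕ) :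
    threeTermPoly (fun r => (r + 1) * v) (r + 1) =
      X * threeTermPoly (fun r => (r + 1) * v) r -
        C v * derivative (threeTermPoly (fun r => (r + 1) * v) r) := by
  cases r with
  | zero => simp [threeTermPoly]
  | succ r =>
    rw [derivative_threeTermPoly, threeTermPoly]
    simp only [map_mul, map_add, map_natCast, map_one]
    ring

theorem hermite_eq_threeTermPoly (r : ℕ) :
    hermite r = threeTermPoly (fun r => (r : ℤ) + 1) r := by
  have hone : (fun r : ℕ => (r : ℤ) + 1) = fun r : ℕ => ((r : ℤ) + 1) * 1 := by simp
  rw [hone]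
  induction r with
  | zero => simp [threeTermPoly]
  | succ r ih => rw [hermite_succ, threeTermPoly_succ_eq_sub_derivative, ih, C_1, one_mul]

theorem hermite_add_two (r : ℕ) :
    hermite (r + 2) = X * hermite (r + 1) - C ((r : ℤ) + 1) * hermite r := by
  simp only [hermite_eq_threeTermPoly, threeTermPoly]

end ThreeTermRecursion

section OrthogonalPolynomials

open Polynomial

variable {α 𝕜 : Type*} [CommRing 𝕜] [TopologicalSpace 𝕜] [IsTopologicalRing 𝕜] {l : Filter α}

theorem testTendsto_threeTermPoly {c : α → ℕ → 𝕜} {c₀ : ℕ → 𝕜}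
    (hc : ∀ r, Tendsto (fun i => c i r) l (𝓝 (c₀ r))) (r : ℕ) :
    TestTendsto 𝕜 (fun i => threeTermPoly (c i) r) l (threeTermPoly c₀ r) := by
  induction r using Nat.twoStepInduction with
  | zero => exact testTendsto_const _
  | one => exact testTendsto_const _
  | more r ih ih' =>
    simp only [threeTermPoly, ← smul_eq_C_mul]
    exact ((testTendsto_const X).mul ih').sub (.smul (hc r) ih)

theorem tendsto_of_orthogonal_threeTermPoly {c : α → ℕ → 𝕜} {c₀ : ℕ → 𝕜}
    {φ : α → 𝕜[X] →ₗ[𝕜] 𝕜} {φ₀ : 𝕜[X] →ₗ[𝕜] 𝕜}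
    (hc : ∀ r, Tendsto (fun i => c i r) l (𝓝 (c₀ r)))
    (hφ : ∀ i r, φ i (threeTermPoly (c i) r) = if r = 0 then 1 else 0)
    (hφ₀ : ∀ r, φ₀ (threeTermPoly c₀ r) = if r = 0 then 1 else 0) (q : 𝕜[X]) :
    Tendsto (fun i => φ i q) l (𝓝 (φ₀ q)) := by
  have hmul (c : ℕ → 𝕜) (r : ℕ) :
      X * threeTermPoly c (r + 1) = threeTermPoly c (r + 2) + c r • threeTermPoly c r := by
    rw [threeTermPoly, smul_eq_C_mul, sub_add_cancel]
  have hpow (k r : ℕ) : Tendsto (fun i => φ i (X ^ k * threeTermPoly (c i) r)) l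
      (𝓝 (φ₀ (X ^ k * threeTermPoly c₀ r))) := by
    induction k generalizing r with
    | zero => simpa only [pow_zero, one_mul, hφ, hφ₀] using tendsto_const_nhds
    | succ k ih =>
      cases r with
      | zero => simpa only [pow_succ, threeTermPoly, mul_one] using ih 1
      | succ r =>
        simpa only [pow_succ, mul_assoc, hmul, mul_add, mul_smul_comm, map_add, map_smul] using
          (ih (r + 2)).add ((hc r).smul (ih r))
  induction q using Polynomial.induction_on' with
  | add p q hp hq => simpa only [map_add] using hp.add hq
  | monomial k a =>
    simpa only [← C_mul_X_pow_eq_monomial, ← smul_eq_C_mul, map_smul, threeTermPoly, mul_one]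
      using (hpow k 0).const_smul a

end OrthogonalPolynomials

section Increments

open MvPolynomial

variable {α ι 𝕜 : Type*} [CommRing 𝕜]

/-- The independence of increments from the past, as a property of the linear form computing joint
moments: it is multiplicative on products of a polynomial in the variables up to time `s` and a
polynomial in one later increment `X t - X s`. -/
def FactorsIncrements [Preorder ι] (φ : MvPolynomial ι 𝕜 →ₗ[𝕜] 𝕜) : Prop :=
  ∀ ⦃s t⦄, s ≤ t → ∀ q ∈ supported 𝕜 (Set.Iic s), ∀ f : Polynomial 𝕜,
    φ (q * Polynomial.aeval (X t - X s) f) = φ q * φ (Polynomial.aeval (X t - X s) f)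

theorem supported_insert_le (S : Set ι) {s u : ι} (hs : s ∈ S) :
    (supported 𝕜 (insert u S)).toSubmodule ≤
      (supported 𝕜 S).toSubmodule * (Algebra.adjoin 𝕜 {X u - X s}).toSubmodule := by
  rw [supported_eq_adjoin_X (s := S), ← Algebra.adjoin_union_coe_submodule,
    OrderEmbedding.le_iff_le]
  have hX {t : ι} (ht : t ∈ S) :
      (X t : MvPolynomial ι 𝕜) ∈ Algebra.adjoin 𝕜 (X '' S ∪ {X u - X s}) :=
    Algebra.subset_adjoin (.inl ⟨t, ht, rfl⟩)
  refine Algebra.adjoin_le ?_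
  rintro _ ⟨t, rfl | ht, rfl⟩
  · simpa only [SetLike.mem_coe, sub_add_cancel] using
      add_mem (Algebra.subset_adjoin (.inr rfl)) (hX hs)
  · exact hX ht

theorem tendsto_of_tendsto_increments [LinearOrder ι] [OrderBot ι]
    [TopologicalSpace 𝕜] [IsTopologicalSemiring 𝕜] {l : Filter α} {φ : α → MvPolynomial ι 𝕜 →ₗ[𝕜] 𝕜}
    {φ₀ : MvPolynomial ι 𝕜 →ₗ[𝕜] 𝕜} (hφ : ∀ i, FactorsIncrements (φ i))
    (hφ₀ : FactorsIncrements φ₀)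
    (hbot : ∀ f : Polynomial 𝕜, Tendsto (fun i => φ i (Polynomial.aeval (X ⊥) f)) l
      (𝓝 (φ₀ (Polynomial.aeval (X ⊥) f))))
    (hinc : ∀ s t, s ≤ t → ∀ f : Polynomial 𝕜,
      Tendsto (fun i => φ i (Polynomial.aeval (X t - X s) f)) l
        (𝓝 (φ₀ (Polynomial.aeval (X t - X s) f))))
    (q : MvPolynomial ι 𝕜) : Tendsto (fun i => φ i q) l (𝓝 (φ₀ q)) := by
  suffices h : ∀ T : Finset ι, ∀ q ∈ supported 𝕜 (insert ⊥ (T : Set ι)),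
      Tendsto (fun i => φ i q) l (𝓝 (φ₀ q)) from
    h q.vars q (mem_supported.2 (Set.subset_insert _ _))
  intro T
  induction T using Finset.induction_on_max with
  | empty =>
    intro q hq
    rw [Finset.coe_empty, insert_empty_eq, supported_eq_adjoin_X, Set.image_singleton,
      Algebra.adjoin_singleton_eq_range_aeval] at hq
    obtain ⟨f, rfl⟩ := hq
    exact hbot f
  | insert u T hu ih =>
    intro q hq
    obtain ⟨s, hs, hmax⟩ := (insert ⊥ T).exists_max_image id (Finset.insert_nonempty _ _)
    rw [← Finset.mem_coe, Finset.coe_insert] at hs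
    have hsu : s ≤ u := by
      obtain rfl | hs := hs
      · exact bot_le
      · exact (hu s hs).le
    have hT : supported 𝕜 (insert ⊥ (T : Set ι)) ≤ supported 𝕜 (Set.Iic s) :=
      supported_mono fun t ht => hmax t (by simpa using ht)
    rw [Finset.coe_insert, Set.insert_comm] at hq
    replace hq := supported_insert_le _ hs hq
    induction hq using Submodule.mul_induction_on' with
    | mem_mul_mem p hp y hy =>
      rw [Algebra.adjoin_singleton_eq_range_aeval, Subalgebra.mem_toSubmodule,
        AlgHom.mem_range] at hy
      obtain ⟨f, rfl⟩ := hy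
      simp only [hφ _ hsu p (hT hp) f, hφ₀ hsu p (hT hp) f]
      exact (ih p hp).mul (hinc s u hsu f)
    | add p _ q _ hp hq => simpa only [map_add] using hp.add hq

end Increments

section Group

variable {G : Type*} [Group G]

theorem canonicalTrace_of [DecidableEq G] (g : G) :
    canonicalTrace G (MonoidAlgebra.of ℂ G g) = if g = 1 then 1 else 0 := by
  change (MonoidAlgebra.of ℂ G g).coeff 1 = _
  simp [Finsupp.single_apply]

theorem mem_span_of_mem_adjoin_of {H : Subgroup G} {x : MonoidAlgebra ℂ G}
    (hx : x ∈ Algebra.adjoin ℂ (MonoidAlgebra.of ℂ G '' H)) :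
    x ∈ Submodule.span ℂ (MonoidAlgebra.of ℂ G '' H) := by
  have hH : MonoidAlgebra.of ℂ G '' H = H.toSubmonoid.map (MonoidAlgebra.of ℂ G) := rfl
  rwa [hH, ← Subalgebra.mem_toSubmodule, Algebra.adjoin_eq_span, Submonoid.closure_eq] at hx

theorem canonicalTrace_mul_of_disjoint {H K : Subgroup G} (hHK : Disjoint H K)
    {x y : MonoidAlgebra ℂ G} (hx : x ∈ Algebra.adjoin ℂ (MonoidAlgebra.of ℂ G '' H))
    (hy : y ∈ Algebra.adjoin ℂ (MonoidAlgebra.of ℂ G '' K)) :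
    canonicalTrace G (x * y) = canonicalTrace G x * canonicalTrace G y := by
  replace hx := mem_span_of_mem_adjoin_of hx
  replace hy := mem_span_of_mem_adjoin_of hy
  induction hx, hy using Submodule.span_induction₂ with
  | mem_mem x y hx hy =>
    obtain ⟨⟨h, hh, rfl⟩, k, hk, rfl⟩ := And.intro hx hy
    classical
    have hone : h * k = 1 ↔ h = 1 ∧ k = 1 :=
      ⟨Subgroup.disjoint_iff_mul_eq_one.1 hHK hh hk, by rintro ⟨rfl, rfl⟩; exact mul_one 1⟩
    simp only [← map_mul, canonicalTrace_of, hone, ite_and, ite_mul, one_mul, zero_mul]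
  | zero_left => simp only [zero_mul, map_zero]
  | zero_right => simp only [mul_zero, map_zero]
  | add_left x y z _ _ _ hx hy => simp only [add_mul, map_add, hx, hy]
  | add_right x y z _ _ _ hx hy => simp only [mul_add, map_add, hx, hy]
  | smul_left c x y _ _ h => simp only [smul_mul_assoc, map_smul, h, smul_eq_mul, mul_assoc]
  | smul_right c x y _ _ h =>
    simp only [mul_smul_comm, map_smul, h, smul_eq_mul, mul_left_comm]

end Group

section SetSum

open scoped symmDiff

theorem card_tuples_image_eq {α : Type*} [DecidableEq α] {A I : Finset α} {r : ℕ}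
    (hA : A.card = r) (hI : A ⊆ I) :
    ({a ∈ Fintype.piFinset fun _ : Fin r => I | Function.Injective a ∧ Finset.univ.image a = A} :
      Finset (Fin r → α)).card = r.factorial := by
  have hcard : Fintype.card (Fin r ≃ A) = r.factorial := by
    rw [Fintype.card_equiv (A.equivFinOfCardEq hA).symm, Fintype.card_fin]
  rw [← hcard, ← Finset.card_univ]
  symm
  refine Finset.card_bij (fun e _ i => (e i : α)) (fun e _ => ?_) (fun e _ e' _ h => ?_)
    (fun a ha => ?_)
  · have himage : Finset.univ.image (fun i => (e i : α)) = A := by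
      rw [← Function.comp_def, ← Finset.image_image, Finset.image_univ_equiv,
        Finset.univ_eq_attach, Finset.attach_image_val]
    simp only [Finset.mem_filter, Fintype.mem_piFinset]
    exact ⟨fun i => hI (e i).2, Subtype.val_injective.comp e.injective, himage⟩
  · exact Equiv.ext fun i => Subtype.ext (congrFun h i)
  · obtain ⟨-, hinj, himage⟩ := Finset.mem_filter.1 ha
    have hmem (i : Fin r) : a i ∈ A := himage ▸ Finset.mem_image_of_mem a (Finset.mem_univ i)
    have hbij : Function.Bijective fun i => (⟨a i, hmem i⟩ : A) :=
      (Fintype.bijective_iff_injective_and_card _).2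
        ⟨fun i j h => hinj (congrArg Subtype.val h), by simp [hA]⟩
    exact ⟨Equiv.ofBijective _ hbij, Finset.mem_univ _, rfl⟩

theorem sum_distinctTuples_image {M : Type*} [AddCommMonoid M] (f : Finset ℕ → M) (r n : ℕ)
    (t : ℝ≥0) :
    ∑ a ∈ distinctTuples r n t, f (Finset.univ.image a) =
      r.factorial • ∑ A ∈ (Finset.Icc 1 ⌊(n : ℝ) * t⌋₊).powersetCard r, f A := by
  have hmaps : ∀ a ∈ distinctTuples r n t,
      Finset.univ.image a ∈ (Finset.Icc 1 ⌊(n : ℝ) * t⌋₊).powersetCard r := fun a ha => by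
    obtain ⟨hI, hinj⟩ := Finset.mem_filter.1 ha
    refine Finset.mem_powersetCard.2 ⟨?_, by simp [Finset.card_image_of_injective _ hinj]⟩
    exact Finset.image_subset_iff.2 fun i _ => Fintype.mem_piFinset.1 hI i
  rw [← Finset.sum_fiberwise_of_maps_to hmaps, Finset.smul_sum]
  refine Finset.sum_congr rfl fun A hA => ?_
  obtain ⟨hI, hcard⟩ := Finset.mem_powersetCard.1 hA
  rw [distinctTuples, Finset.filter_filter, ← card_tuples_image_eq hcard hI,
    ← Finset.sum_const]
  refine Finset.sum_congr rfl fun a ha => ?_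
  rw [(Finset.mem_filter.1 ha).2.2]

/-- The singleton `{a}`, seen as an element of the group algebra. -/
noncomputable def singletonElement (a : ℕ) : MonoidAlgebra ℂ FinsetGroup :=
  MonoidAlgebra.of ℂ FinsetGroup (FinsetGroup.mk {a})

theorem singletonElement_sq (a : ℕ) : singletonElement a ^ 2 = 1 := by
  rw [singletonElement, ← map_pow, pow_two, FinsetGroup.mk_mul, symmDiff_self, Finset.bot_eq_empty,
    FinsetGroup.mk_empty, map_one]

theorem prod_singletonElement (A : Finset ℕ) :
    ∏ a ∈ A, singletonElement a = MonoidAlgebra.of ℂ FinsetGroup (FinsetGroup.mk A) := by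
  induction A using Finset.induction_on with
  | empty => rw [Finset.prod_empty, FinsetGroup.mk_empty, map_one]
  | insert a A ha ih =>
    rw [Finset.prod_insert ha, ih, singletonElement, ← map_mul, FinsetGroup.mk_mul,
      (Finset.disjoint_singleton_left.2 ha).symmDiff_eq_sup, Finset.sup_eq_union,
      ← Finset.insert_eq]

theorem esymm_singletonElement (I : Finset ℕ) (r : ℕ) :
    (I.val.map singletonElement).esymm r =
      ∑ A ∈ I.powersetCard r, MonoidAlgebra.of ℂ FinsetGroup (FinsetGroup.mk A) := by
  simp only [Finset.esymm_map_val, prod_singletonElement]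

theorem canonicalTrace_esymm_singletonElement (I : Finset ℕ) (r : ℕ) :
    canonicalTrace FinsetGroup ((I.val.map singletonElement).esymm r) =
      if r = 0 then 1 else 0 := by
  classical
  rw [esymm_singletonElement, map_sum]
  obtain rfl | hr := eq_or_ne r 0
  · rw [Finset.powersetCard_zero, Finset.sum_singleton, FinsetGroup.mk_empty, canonicalTrace_of,
      if_pos rfl, if_pos rfl]
  · rw [if_neg hr]
    refine Finset.sum_eq_zero fun A hA => ?_
    have hA' : A.card = r := (Finset.mem_powersetCard.1 hA).2
    rw [canonicalTrace_of, if_neg]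
    rintro (rfl : A = ∅)
    exact hr (by simpa using hA'.symm)

/-- The sum of the singletons of `I` divided by `√n`: the increment of `L_1(n, ·)` over a time
interval with indices `I`. -/
noncomputable def blockSum (n : ℕ) (I : Finset ℕ) : MonoidAlgebra ℂ FinsetGroup :=
  (((n : ℝ) ^ (-(1 / 2) : ℝ) : ℝ) : ℂ) • ∑ a ∈ I, singletonElement a

/-- The Jacobi coefficients of the sum of `N` independent signs divided by `√n`, whose orthogonal
polynomials are the Krawtchouk polynomials. They vanish for `n = 0` by division by zero, in
agreement with `blockSum 0 I = 0`. -/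
noncomputable def krawtchoukCoeff (n N r : ℕ) : ℂ := (r + 1) * (N - r) / n

theorem aeval_blockSum_threeTermPoly (n : ℕ) (I : Finset ℕ) (r : ℕ) :
    Polynomial.aeval (blockSum n I) (threeTermPoly (krawtchoukCoeff n I.card) r) =
      ((((n : ℝ) ^ (-(r : ℝ) / 2) : ℝ) : ℂ) * r.factorial) •
        (I.val.map singletonElement).esymm r := by
  have hpow (r : ℕ) :
      (((n : ℝ) ^ (-(1 / 2) : ℝ) : ℝ) : ℂ) ^ r = ((n : ℝ) ^ (-(r : ℝ) / 2) : ℝ) := by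
    rw [← Complex.ofReal_pow, ← Real.rpow_mul_natCast n.cast_nonneg]
    ring_nf
  have hsq : (((n : ℝ) ^ (-(1 / 2) : ℝ) : ℝ) : ℂ) ^ 2 = (n : ℂ)⁻¹ := by
    rw [hpow, Nat.cast_ofNat, neg_div_self two_ne_zero, Real.rpow_neg_one, Complex.ofReal_inv,
      Complex.ofReal_natCast]
  have h := aeval_threeTermPoly_eq_esymm (s := I.val.map singletonElement)
    (by simp [singletonElement_sq]) (((n : ℝ) ^ (-(1 / 2) : ℝ) : ℝ) : ℂ) r
  rw [hsq, hpow, Multiset.card_map] at h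
  exact h

theorem setSum_eq_smul_esymm (r n : ℕ) (t : ℝ≥0) :
    setSum r n t = ((((n : ℝ) ^ (-(r : ℝ) / 2) : ℝ) : ℂ) * r.factorial) •
      ((Finset.Icc 1 ⌊(n : ℝ) * t⌋₊).val.map singletonElement).esymm r := by
  rw [setSum, sum_distinctTuples_image fun A => MonoidAlgebra.of ℂ _ (FinsetGroup.mk A),
    esymm_singletonElement, mul_smul, Nat.cast_smul_eq_nsmul]

theorem setSum_one_eq_blockSum (n : ℕ) (t : ℝ≥0) :
    setSum 1 n t = blockSum n (Finset.Icc 1 ⌊(n : ℝ) * t⌋₊) := by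
  rw [setSum_eq_smul_esymm, ← aeval_blockSum_threeTermPoly, threeTermPoly, Polynomial.aeval_X]

theorem setSum_eq_aeval_threeTermPoly (r n : ℕ) (t : ℝ≥0) :
    setSum r n t = Polynomial.aeval (setSum 1 n t)
      (threeTermPoly (krawtchoukCoeff n ⌊(n : ℝ) * t⌋₊) r) := by
  have h := aeval_blockSum_threeTermPoly n (Finset.Icc 1 ⌊(n : ℝ) * t⌋₊) r
  rw [Nat.card_Icc, Nat.add_sub_cancel] at h
  rw [setSum_one_eq_blockSum, h, setSum_eq_smul_esymm]

theorem freeAlgebraLift_setSum {ι : Type*} (r : ι → ℕ) (t : ι → ℝ≥0) (p : FreeAlgebra ℂ ι)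
    (n : ℕ) :
    FreeAlgebra.lift ℂ (fun i => setSum (r i) n (t i)) p =
      MvPolynomial.aeval (setSum 1 n) (FreeAlgebra.lift ℂ (fun i =>
        Polynomial.aeval (MvPolynomial.X (t i) : MvPolynomial ℝ≥0 ℂ)
          (threeTermPoly (krawtchoukCoeff n ⌊(n : ℝ) * t i⌋₊) (r i))) p) := by
  simp only [map_freeAlgebraLift, ← Polynomial.aeval_algHom_apply, MvPolynomial.aeval_X,
    ← setSum_eq_aeval_threeTermPoly]

theorem setSum_one_sub (n : ℕ) {s t : ℝ≥0} (hst : s ≤ t) :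
    setSum 1 n t - setSum 1 n s =
      blockSum n (Finset.Ioc ⌊(n : ℝ) * s⌋₊ ⌊(n : ℝ) * t⌋₊) := by
  have hle : ⌊(n : ℝ) * s⌋₊ ≤ ⌊(n : ℝ) * t⌋₊ := by gcongr
  have hIcc (N : ℕ) : Finset.Icc 1 N = Finset.Ioc 0 N := rfl
  rw [setSum_one_eq_blockSum, setSum_one_eq_blockSum, blockSum, blockSum, blockSum, ← smul_sub,
    hIcc, hIcc, ← Finset.sum_Ioc_consecutive _ (Nat.zero_le _) hle, add_sub_cancel_left]

theorem canonicalTrace_aeval_blockSum (n : ℕ) (I : Finset ℕ) (r : ℕ) :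
    canonicalTrace FinsetGroup
      (Polynomial.aeval (blockSum n I) (threeTermPoly (krawtchoukCoeff n I.card) r)) =
      if r = 0 then 1 else 0 := by
  rw [aeval_blockSum_threeTermPoly, map_smul, canonicalTrace_esymm_singletonElement]
  split_ifs with hr
  · simp [hr]
  · rw [smul_zero]

/-- The subgroup of the finite sets contained in `S`. -/
def finsetsIn (S : Set ℕ) : Subgroup FinsetGroup where
  carrier := FinsetGroup.mk '' {A | ↑A ⊆ S}
  one_mem' := ⟨∅, by simp, FinsetGroup.mk_empty⟩
  mul_mem' := by
    rintro _ _ ⟨A, hA, rfl⟩ ⟨B, hB, rfl⟩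
    refine ⟨A ∆ B, ?_, (FinsetGroup.mk_mul A B).symm⟩
    rw [Set.mem_ofPred_eq, Finset.coe_symmDiff]
    exact Set.symmDiff_subset_union.trans (Set.union_subset hA hB)
  inv_mem' := id

theorem disjoint_finsetsIn {S T : Set ℕ} (hST : Disjoint S T) :
    Disjoint (finsetsIn S) (finsetsIn T) := by
  rw [Subgroup.disjoint_def]
  rintro _ ⟨A, hS, rfl⟩ ⟨B, hT, hBA : B = A⟩
  have hA : A = ∅ := by
    simpa using Set.subset_empty_iff.1 ((Set.subset_inter hS (hBA ▸ hT)).trans hST.le_bot)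
  rw [hA, FinsetGroup.mk_empty]

theorem blockSum_mem_adjoin {I : Finset ℕ} {S : Set ℕ} (hI : ↑I ⊆ S) (n : ℕ) :
    blockSum n I ∈ Algebra.adjoin ℂ (MonoidAlgebra.of ℂ FinsetGroup '' finsetsIn S) := by
  refine Subalgebra.smul_mem _ (Subalgebra.sum_mem _ fun a ha => ?_) _
  exact Algebra.subset_adjoin ⟨_, ⟨{a}, by simpa using hI ha, rfl⟩, rfl⟩

theorem aeval_setSum_mem_adjoin (n : ℕ) {s : ℝ≥0} {q : MvPolynomial ℝ≥0 ℂ}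
    (hq : q ∈ MvPolynomial.supported ℂ (Set.Iic s)) :
    MvPolynomial.aeval (setSum 1 n) q ∈ Algebra.adjoin ℂ
      (MonoidAlgebra.of ℂ FinsetGroup '' finsetsIn (Set.Iic ⌊(n : ℝ) * s⌋₊)) := by
  rw [← Subalgebra.mem_comap]
  refine Algebra.adjoin_le ?_ hq
  rintro _ ⟨u, hu : u ≤ s, rfl⟩
  rw [SetLike.mem_coe, Subalgebra.mem_comap, MvPolynomial.aeval_X, setSum_one_eq_blockSum]
  refine blockSum_mem_adjoin (fun a ha => ?_) n
  have hle : ⌊(n : ℝ) * u⌋₊ ≤ ⌊(n : ℝ) * s⌋₊ := by gcongr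
  exact (Finset.mem_Icc.1 ha).2.trans hle

theorem factorsIncrements_setSum (n : ℕ) :
    FactorsIncrements (canonicalTrace FinsetGroup ∘ₗ
      (MvPolynomial.aeval (R := ℂ) (setSum 1 n)).toLinearMap) := by
  intro s t hst q hq f
  simp only [LinearMap.comp_apply, AlgHom.toLinearMap_apply, map_mul, map_sub,
    ← Polynomial.aeval_algHom_apply, MvPolynomial.aeval_X, setSum_one_sub n hst]
  refine canonicalTrace_mul_of_disjoint (disjoint_finsetsIn (T := Set.Ioi ⌊(n : ℝ) * s⌋₊) ?_)
    (aeval_setSum_mem_adjoin n hq) ?_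
  · exact Set.Iic_disjoint_Ioi le_rfl
  · have hI := blockSum_mem_adjoin (I := Finset.Ioc ⌊(n : ℝ) * s⌋₊ ⌊(n : ℝ) * t⌋₊)
      (fun a ha => (Finset.mem_Ioc.1 ha).1) n
    exact Algebra.adjoin_le (Set.singleton_subset_iff.2 hI)
      (Polynomial.aeval_mem_adjoin_singleton ℂ _)

theorem tendsto_krawtchoukCoeff {N : ℕ → ℕ} {v : ℝ≥0}
    (hN : Tendsto (fun n => (N n : ℝ) / n) atTop (𝓝 v)) (r : ℕ) :
    Tendsto (fun n => krawtchoukCoeff n (N n) r) atTop (𝓝 ((r + 1) * (v : ℂ))) := by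
  have hr : Tendsto (fun n : ℕ => (r : ℂ) / n) atTop (𝓝 0) :=
    tendsto_const_div_atTop_nhds_zero_nat _
  have hN' : Tendsto (fun n => (N n : ℂ) / n) atTop (𝓝 (v : ℂ)) := by
    simpa [Function.comp_def] using (Complex.continuous_ofReal.tendsto _).comp hN
  simpa only [krawtchoukCoeff, mul_div_assoc, sub_div, sub_zero] using
    (hN'.sub hr).const_mul ((r : ℂ) + 1)

theorem tendsto_floor_mul_div (t : ℝ≥0) :
    Tendsto (fun n : ℕ => (⌊(n : ℝ) * t⌋₊ : ℝ) / n) atTop (𝓝 t) := by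
  simpa only [mul_comm, Function.comp_def] using
    (tendsto_nat_floor_mul_div_atTop t.coe_nonneg).comp tendsto_natCast_atTop_atTop

theorem tendsto_card_Ioc_div {s t : ℝ≥0} (hst : s ≤ t) :
    Tendsto (fun n : ℕ => ((Finset.Ioc ⌊(n : ℝ) * s⌋₊ ⌊(n : ℝ) * t⌋₊).card : ℝ) / n) atTop
      (𝓝 (t - s : ℝ≥0)) := by
  have h (n : ℕ) : ⌊(n : ℝ) * s⌋₊ ≤ ⌊(n : ℝ) * t⌋₊ := by gcongr
  simpa only [Nat.card_Ioc, Nat.cast_sub (h _), sub_div, NNReal.coe_sub hst] using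
    (tendsto_floor_mul_div t).sub (tendsto_floor_mul_div s)

end SetSum

section Moments

variable {Ω : Type*} [MeasurableSpace Ω] {P : Measure Ω}

/-- A random variable all of whose absolute moments are finite. -/
def HasAllMoments {E : Type*} [NormedAddCommGroup E] (Z : Ω → E) (P : Measure Ω) : Prop :=
  ∀ p : ℝ≥0, MemLp Z p P

namespace HasAllMoments

theorem integrable {E : Type*} [NormedAddCommGroup E] {Z : Ω → E} (hZ : HasAllMoments Z P) :
    Integrable Z P :=
  memLp_one_iff_integrable.1 (by simpa only [ENNReal.coe_one] using hZ 1)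

theorem mul {Z W : Ω → ℂ} (hZ : HasAllMoments Z P) (hW : HasAllMoments W P) :
    HasAllMoments (fun ω => Z ω * W ω) P := fun p => by
  have hp : ENNReal.HolderTriple ((2 * p : ℝ≥0) : ENNReal) ((2 * p : ℝ≥0) : ENNReal) p :=
    ⟨by rw [ENNReal.coe_mul, ENNReal.mul_inv (by simp) (by simp), ← add_mul, ENNReal.coe_ofNat,
      ENNReal.inv_two_add_inv_two, one_mul]⟩
  exact (hW (2 * p)).mul' (hZ (2 * p))

theorem mvPolynomial_aeval [IsFiniteMeasure P] {ι : Type*} {X : ι → Ω → ℝ}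
    (hX : ∀ i, HasAllMoments (X i) P) (q : MvPolynomial ι ℂ) :
    HasAllMoments (fun ω => MvPolynomial.aeval (fun i => (X i ω : ℂ)) q) P := by
  induction q using MvPolynomial.induction_on with
  | C a =>
    simp only [MvPolynomial.aeval_C]
    exact fun p => memLp_const _
  | add q q' hq hq' =>
    simp only [map_add]
    exact fun p => (hq p).add (hq' p)
  | mul_X q i hq =>
    simp only [map_mul, MvPolynomial.aeval_X]
    exact hq.mul fun p => (hX i p).ofReal

theorem polynomial_aeval [IsFiniteMeasure P] {Z : Ω → ℝ} (hZ : HasAllMoments Z P)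
    (f : Polynomial ℂ) : HasAllMoments (fun ω => Polynomial.aeval (Z ω : ℂ) f) P := by
  simpa only [← Polynomial.aeval_algHom_apply, MvPolynomial.aeval_X] using
    mvPolynomial_aeval (ι := Unit) (fun _ => hZ) (Polynomial.aeval (MvPolynomial.X ()) f)

end HasAllMoments

theorem measurable_mvPolynomial_aeval {ι : Type*} (q : MvPolynomial ι ℂ) :
    Measurable fun x : ι → ℝ => MvPolynomial.aeval (fun i => (x i : ℂ)) q := by
  induction q using MvPolynomial.induction_on with
  | C a => simp only [MvPolynomial.aeval_C, measurable_const]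
  | add q q' hq hq' =>
    simp only [map_add]
    exact hq.add hq'
  | mul_X q i hq =>
    simp only [map_mul, MvPolynomial.aeval_X]
    exact hq.mul (Complex.measurable_ofReal.comp (measurable_pi_apply i))

/-- The joint moments of a family of real random variables, as a linear form on polynomials. -/
noncomputable def momentFunctional [IsFiniteMeasure P] {ι : Type*} {X : ι → Ω → ℝ}
    (hX : ∀ i, HasAllMoments (X i) P) : MvPolynomial ι ℂ →ₗ[ℂ] ℂ where
  toFun q := ∫ ω, MvPolynomial.aeval (fun i => (X i ω : ℂ)) q ∂P
  map_add' q q' := by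
    simp only [map_add]
    exact integral_add (HasAllMoments.mvPolynomial_aeval hX q).integrable
      (HasAllMoments.mvPolynomial_aeval hX q').integrable
  map_smul' c q := by simp only [map_smul, integral_smul, RingHom.id_apply]

theorem momentFunctional_apply [IsFiniteMeasure P] {ι : Type*} {X : ι → Ω → ℝ}
    (hX : ∀ i, HasAllMoments (X i) P) (q : MvPolynomial ι ℂ) :
    momentFunctional hX q = ∫ ω, MvPolynomial.aeval (fun i => (X i ω : ℂ)) q ∂P := rfl

end Moments

section Gaussian

theorem iteratedDeriv_id_mul_zero {𝕜 : Type*} [NontriviallyNormedField 𝕜] {f : 𝕜 → 𝕜} {k : ℕ}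
    (hf : ContDiffAt 𝕜 (k + 1) f 0) :
    iteratedDeriv (k + 1) (fun t => t * f t) 0 = (k + 1) * iteratedDeriv k f 0 := by
  rw [iteratedDeriv_fun_mul contDiffAt_fun_id (mod_cast hf),
    Finset.sum_eq_single_of_mem 1 (by simp)]
  · simp [iteratedDeriv_fun_id_zero]
  · intro i _ hi
    simp [iteratedDeriv_fun_id_zero, hi]

theorem integral_pow_eq_iteratedDeriv_mgf (v : ℝ≥0) (k : ℕ) :
    ∫ x, x ^ k ∂gaussianReal 0 v =
      iteratedDeriv k (fun t => Real.exp (v * t ^ 2 / 2)) 0 := by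
  have hmgf : mgf id (gaussianReal 0 v) = fun t => Real.exp (v * t ^ 2 / 2) := by
    simp only [mgf_id_gaussianReal, zero_mul, zero_add]
  rw [← hmgf, iteratedDeriv_mgf_zero (by simp [integrableExpSet_id_gaussianReal])]
  rfl

theorem integral_pow_add_two_gaussianReal (v : ℝ≥0) (k : ℕ) :
    ∫ x, x ^ (k + 2) ∂gaussianReal 0 v = (k + 1) * v * ∫ x, x ^ k ∂gaussianReal 0 v := by
  set f : ℝ → ℝ := fun t => Real.exp (v * t ^ 2 / 2)
  have hf : ContDiff ℝ (k + 1) f := by fun_prop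
  have hderiv : deriv f = fun t => t * (v * f t) := by
    funext t
    have h : HasDerivAt (fun t : ℝ => v * t ^ 2 / 2) (v * t) t := by
      refine (((hasDerivAt_pow 2 t).const_mul (v : ℝ)).div_const 2).congr_deriv ?_
      ring
    rw [h.exp.deriv]
    ring
  rw [integral_pow_eq_iteratedDeriv_mgf, integral_pow_eq_iteratedDeriv_mgf, iteratedDeriv_succ',
    hderiv, iteratedDeriv_id_mul_zero (contDiff_const.mul hf).contDiffAt,
    iteratedDeriv_const_mul_field,
    mul_assoc]

theorem integrable_aeval_gaussianReal (v : ℝ≥0) (q : Polynomial ℂ) :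
    Integrable (fun x : ℝ => Polynomial.aeval (x : ℂ) q) (gaussianReal 0 v) :=
  (HasAllMoments.polynomial_aeval (Z := id) memLp_id_gaussianReal q).integrable

theorem integral_mul_aeval_gaussianReal (v : ℝ≥0) (q : Polynomial ℂ) :
    ∫ x : ℝ, x * Polynomial.aeval (x : ℂ) q ∂gaussianReal 0 v =
      v * ∫ x : ℝ, Polynomial.aeval (x : ℂ) q.derivative ∂gaussianReal 0 v := by
  induction q using Polynomial.induction_on' with
  | add p q hp hq =>
    have hintX (f : Polynomial ℂ) :
        Integrable (fun x : ℝ => (x : ℂ) * Polynomial.aeval (x : ℂ) f) (gaussianReal 0 v) := by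
      have h := integrable_aeval_gaussianReal v (Polynomial.X * f)
      simp only [map_mul, Polynomial.aeval_X] at h
      exact h
    simp only [map_add, mul_add]
    rw [integral_add (hintX p) (hintX q), hp, hq, ← mul_add,
      integral_add (integrable_aeval_gaussianReal v _) (integrable_aeval_gaussianReal v _)]
  | monomial k a =>
    have hpow (m : ℕ) : ∫ x : ℝ, (x : ℂ) ^ m ∂gaussianReal 0 v =
        ((∫ x, x ^ m ∂gaussianReal 0 v : ℝ) : ℂ) := by
      simp only [← Complex.ofReal_pow, integral_complex_ofReal]
    simp only [Polynomial.derivative_monomial, Polynomial.aeval_monomial,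
      mul_left_comm _ (algebraMap ℂ ℂ _), ← pow_succ', integral_const_mul, hpow]
    cases k with
    | zero => simp
    | succ k =>
      rw [integral_pow_add_two_gaussianReal]
      simp only [Algebra.algebraMap_self, RingHom.id_apply, Complex.ofReal_mul, Complex.ofReal_add,
        Complex.ofReal_natCast, Complex.ofReal_one, Nat.cast_add, Nat.cast_one,
        add_tsub_cancel_right]
      ring

theorem integral_aeval_threeTermPoly_gaussianReal (v : ℝ≥0) (r : ℕ) :
    ∫ x : ℝ, Polynomial.aeval (x : ℂ)
        (threeTermPoly (fun r => (r + 1) * (v : ℂ)) r) ∂gaussianReal 0 v =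
      if r = 0 then 1 else 0 := by
  cases r with
  | zero => simp [threeTermPoly]
  | succ r =>
    have hmul {p q : Polynomial ℂ} :
        Integrable (fun x : ℝ => Polynomial.aeval (x : ℂ) p * Polynomial.aeval (x : ℂ) q)
          (gaussianReal 0 v) := by
      simpa only [map_mul] using integrable_aeval_gaussianReal v (p * q)
    rw [threeTermPoly_succ_eq_sub_derivative, if_neg r.succ_ne_zero]
    simp only [map_sub, map_mul]
    rw [integral_sub hmul hmul]
    simp only [Polynomial.aeval_X, Polynomial.aeval_C, integral_const_mul,
      integral_mul_aeval_gaussianReal]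
    exact sub_self _

end Gaussian

section HermitePolynomials

theorem scaledHermite_one {t : ℝ≥0} {x : ℝ} (hx : t = 0 → x = 0) : scaledHermite 1 t x = x := by
  obtain rfl | ht := eq_zero_or_pos t
  · rw [scaledHermite_zero le_rfl, hx rfl]
  · rw [scaledHermite, Polynomial.hermite_one, Polynomial.aeval_X, ← mul_assoc,
      ← Real.rpow_add (NNReal.coe_pos.2 ht), Nat.cast_one, add_neg_cancel, Real.rpow_zero, one_mul]

theorem scaledHermite_add_two (r : ℕ) {t : ℝ≥0} {x : ℝ} (hx : t = 0 → x = 0) :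
    scaledHermite (r + 2) t x =
      x * scaledHermite (r + 1) t x - (r + 1) * t * scaledHermite r t x := by
  obtain rfl | ht := eq_zero_or_pos t
  · rw [scaledHermite_zero (Nat.le_add_left 1 (r + 1)), hx rfl, NNReal.coe_zero]
    ring
  · have ht' : (0 : ℝ) < t := ht
    have hone : (t : ℝ) ^ (((r + 2 : ℕ) : ℝ) / 2) * (t : ℝ) ^ (-(1 / 2) : ℝ) =
        (t : ℝ) ^ (((r + 1 : ℕ) : ℝ) / 2) := by
      rw [← Real.rpow_add ht']
      congr 1
      push_cast
      ring
    have htwo : (t : ℝ) ^ (((r + 2 : ℕ) : ℝ) / 2) = t * (t : ℝ) ^ ((r : ℝ) / 2) := by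
      rw [← Real.rpow_one_add' ht'.le (by positivity)]
      congr 1
      push_cast
      ring
    simp only [scaledHermite, hermite_add_two, ← hone, map_sub, map_mul, Polynomial.aeval_X,
      map_add, map_one, map_natCast]
    rw [htwo]
    ring

theorem scaledHermite_eq_aeval_threeTermPoly (r : ℕ) {t : ℝ≥0} {x : ℝ} (hx : t = 0 → x = 0) :
    (scaledHermite r t x : ℂ) =
      Polynomial.aeval (x : ℂ) (threeTermPoly (fun r => (r + 1) * (t : ℂ)) r) := by
  have h := aeval_threeTermPoly_of_recursion (c := fun r : ℕ => (r + 1) * (t : ℂ))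
    (d := fun r => (scaledHermite r t x : ℂ)) (by simp [scaledHermite]) (fun r => by
      rw [scaledHermite_add_two r hx, scaledHermite_one hx]
      push_cast
      rw [smul_eq_mul]) r
  rw [← h, scaledHermite_one hx]

theorem polyRandomVariable_scaledHermite {ι Ω : Type*} {B : ℝ≥0 → Ω → ℝ} (r : ι → ℕ) (t : ι → ℝ≥0)
    (hB0 : ∀ ω, B 0 ω = 0) (p : FreeAlgebra ℂ ι) (ω : Ω) :
    polyRandomVariable (fun i ω => scaledHermite (r i) (t i) (B (t i) ω)) p ω =
      MvPolynomial.aeval (fun t => (B t ω : ℂ)) (FreeAlgebra.lift ℂ (fun i =>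
        Polynomial.aeval (MvPolynomial.X (t i) : MvPolynomial ℝ≥0 ℂ)
          (threeTermPoly (fun r => (r + 1) * (t i : ℂ)) (r i))) p) := by
  have hzero (i : ι) : t i = 0 → B (t i) ω = 0 := fun h => h ▸ hB0 ω
  simp only [polyRandomVariable, map_freeAlgebraLift, ← Polynomial.aeval_algHom_apply,
    MvPolynomial.aeval_X, scaledHermite_eq_aeval_threeTermPoly _ (hzero _)]

end HermitePolynomials

section BrownianMotion

variable {Ω : Type*} [MeasurableSpace Ω] {P : Measure Ω} [IsProbabilityMeasure P]
  {B : ℝ≥0 → Ω → ℝ}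

omit [IsProbabilityMeasure P] in
theorem hasAllMoments_of_isPreBrownianReal (hB : IsPreBrownianReal B P) (t : ℝ≥0) :
    HasAllMoments (B t) P := fun _ =>
  (hB.isGaussianProcess.hasGaussianLaw_eval t).memLp ENNReal.coe_ne_top

theorem factorsIncrements_momentFunctional (hB : IsPreBrownianReal B P) :
    FactorsIncrements (momentFunctional (hasAllMoments_of_isPreBrownianReal hB)) := by
  intro s t hst q hq f
  have hint := HasAllMoments.mvPolynomial_aeval (hasAllMoments_of_isPreBrownianReal hB)
  rw [MvPolynomial.supported_eq_range_rename, AlgHom.mem_range] at hq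
  obtain ⟨q, rfl⟩ := hq
  obtain ⟨u, rfl⟩ := exists_add_of_le hst
  have hindep : IndepFun
      (fun ω => MvPolynomial.aeval (fun i => (B i ω : ℂ))
        (MvPolynomial.rename (R := ℂ) ((↑) : Set.Iic s → ℝ≥0) q))
      (fun ω => MvPolynomial.aeval (fun i => (B i ω : ℂ))
        (Polynomial.aeval (MvPolynomial.X (s + u) - MvPolynomial.X s : MvPolynomial ℝ≥0 ℂ) f))
      P := by
    have h := (hB.indepFun_shift s).symm.comp (measurable_mvPolynomial_aeval q)
      (measurable_mvPolynomial_aeval (Polynomial.aeval (MvPolynomial.X u) f))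
    simpa [Function.comp_def, MvPolynomial.aeval_rename, ← Polynomial.aeval_algHom_apply] using h
  simp only [momentFunctional_apply, map_mul]
  exact hindep.integral_fun_mul_eq_mul_integral (hint _).integrable.aestronglyMeasurable
    (hint _).integrable.aestronglyMeasurable

theorem momentFunctional_aeval_increment (hB : IsPreBrownianReal B P) {s t : ℝ≥0} (hst : s ≤ t)
    (f : Polynomial ℂ) :
    momentFunctional (hasAllMoments_of_isPreBrownianReal hB)
        (Polynomial.aeval (MvPolynomial.X t - MvPolynomial.X s) f) =
      ∫ x : ℝ, Polynomial.aeval (x : ℂ) f ∂gaussianReal 0 (t - s) := by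
  have hlaw : HasLaw (B t - B s) (gaussianReal 0 (t - s)) P := by
    have hdist : nndist (t : ℝ) s = t - s := by
      ext
      rw [coe_nndist, Real.dist_eq, abs_of_nonneg (sub_nonneg.2 (NNReal.coe_le_coe.2 hst)),
        NNReal.coe_sub hst]
    exact hdist ▸ hB.hasLaw_sub t s
  have h := hlaw.integral_comp (f := fun x : ℝ => Polynomial.aeval (x : ℂ) f)
    (integrable_aeval_gaussianReal _ f).aestronglyMeasurable
  simpa [momentFunctional_apply, ← Polynomial.aeval_algHom_apply, Function.comp_def] using h

theorem tendsto_canonicalTrace_increment (hB : IsPreBrownianReal B P) {s t : ℝ≥0} (hst : s ≤ t)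
    (f : Polynomial ℂ) :
    Tendsto (fun n => canonicalTrace FinsetGroup
        (Polynomial.aeval (setSum 1 n t - setSum 1 n s) f)) atTop
      (𝓝 (momentFunctional (hasAllMoments_of_isPreBrownianReal hB)
        (Polynomial.aeval (MvPolynomial.X t - MvPolynomial.X s) f))) := by
  simp only [setSum_one_sub _ hst]
  exact tendsto_of_orthogonal_threeTermPoly
    (φ := fun n => canonicalTrace FinsetGroup ∘ₗ (Polynomial.aeval (R := ℂ) (blockSum n
      (Finset.Ioc ⌊(n : ℝ) * s⌋₊ ⌊(n : ℝ) * t⌋₊))).toLinearMap)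
    (φ₀ := momentFunctional (hasAllMoments_of_isPreBrownianReal hB) ∘ₗ
      (Polynomial.aeval (R := ℂ) (MvPolynomial.X t - MvPolynomial.X s)).toLinearMap)
    (tendsto_krawtchoukCoeff (tendsto_card_Ioc_div hst))
    (fun n => canonicalTrace_aeval_blockSum n _)
    (fun r => (momentFunctional_aeval_increment hB hst _).trans
      (integral_aeval_threeTermPoly_gaussianReal _ r)) f

theorem tendsto_canonicalTrace_momentFunctional (hB : IsPreBrownianReal B P)
    (q : MvPolynomial ℝ≥0 ℂ) :
    Tendsto (fun n => canonicalTrace FinsetGroup (MvPolynomial.aeval (setSum 1 n) q)) atTop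
      (𝓝 (momentFunctional (hasAllMoments_of_isPreBrownianReal hB) q)) := by
  refine tendsto_of_tendsto_increments factorsIncrements_setSum
    (factorsIncrements_momentFunctional hB) (fun f => ?_) (fun s t hst f => ?_) q
  · have htrace (n : ℕ) : setSum 1 n 0 = setSum 1 n 0 - setSum 1 n 0 := by
      simp [setSum_one_eq_blockSum, blockSum]
    have hmoment : momentFunctional (hasAllMoments_of_isPreBrownianReal hB)
          (Polynomial.aeval (MvPolynomial.X 0) f) =
        momentFunctional (hasAllMoments_of_isPreBrownianReal hB)
          (Polynomial.aeval (MvPolynomial.X 0 - MvPolynomial.X 0) f) := by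
      refine integral_congr_ae ?_
      filter_upwards [hB.eval_zero_ae_eq_zero] with ω hω
      simp only [← Polynomial.aeval_algHom_apply, map_sub, MvPolynomial.aeval_X, hω,
        Complex.ofReal_zero, sub_zero]
    have h := tendsto_canonicalTrace_increment hB le_rfl f (s := 0)
    simp only [← htrace, ← hmoment] at h
    simpa [← Polynomial.aeval_algHom_apply] using h
  · simpa [← Polynomial.aeval_algHom_apply] using tendsto_canonicalTrace_increment hB hst f

theorem integrable_polyRandomVariable_scaledHermite {ι : Type*} (r : ι → ℕ) (t : ι → ℝ≥0)
    (hB : IsPreBrownianReal B P) (hB0 : ∀ ω, B 0 ω = 0) (p : FreeAlgebra ℂ ι) :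
    Integrable (polyRandomVariable (fun i ω => scaledHermite (r i) (t i) (B (t i) ω)) p) P := by
  rw [funext (polyRandomVariable_scaledHermite r t hB0 p)]
  exact (HasAllMoments.mvPolynomial_aeval (hasAllMoments_of_isPreBrownianReal hB) _).integrable

theorem tendsto_ncDistribution_setSum {ι : Type*} (r : ι → ℕ) (t : ι → ℝ≥0)
    (hB : IsPreBrownianReal B P) (hB0 : ∀ ω, B 0 ω = 0) (p : FreeAlgebra ℂ ι) :
    Tendsto (fun n => ncDistribution (canonicalTrace FinsetGroup)
        (fun i => setSum (r i) n (t i)) p) atTop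
      (𝓝 (classicalDistribution P (fun i ω => scaledHermite (r i) (t i) (B (t i) ω)) p)) := by
  have hgen (i : ι) := (testTendsto_threeTermPoly
    (tendsto_krawtchoukCoeff (tendsto_floor_mul_div (t i))) (r i)).map
      (Polynomial.aeval (MvPolynomial.X (t i) : MvPolynomial ℝ≥0 ℂ)).toLinearMap
  have h := TestTendsto.freeAlgebraLift hgen p
    (fun n => canonicalTrace FinsetGroup ∘ₗ
      (MvPolynomial.aeval (R := ℂ) (setSum 1 n)).toLinearMap)
    (momentFunctional (hasAllMoments_of_isPreBrownianReal hB))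
    (tendsto_canonicalTrace_momentFunctional hB)
  simp only [ncDistribution, classicalDistribution, freeAlgebraLift_setSum,
    polyRandomVariable_scaledHermite r t hB0 p]
  exact h

end BrownianMotion

section Schauder

/-- The primitive of the Haar function, supported by `[0, 1]` and peaking at `1 / 2`. -/
noncomputable def tent (x : ℝ) : ℝ := max 0 (min x (1 - x))

/-- The Schauder functions on the half-line, primitives of the Haar orthonormal basis: at level `0`
the ramps between consecutive integers, at level `n + 1` rescaled tents. -/
noncomputable def schauder : ℕ → ℕ → ℝ → ℝ
  | 0, k, t => max 0 (min 1 (t - k))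
  | n + 1, k, t => (√2 ^ n)⁻¹ * tent (2 ^ n * t - k)

/-- The covariance of independent Brownian bridges between consecutive integers. It is the error
made by truncating the Schauder expansion of Brownian motion at level `0`. -/
noncomputable def bridgeCov (x y : ℝ) : ℝ :=
  if ⌊x⌋₊ = ⌊y⌋₊ then min (x - ⌊x⌋₊) (y - ⌊y⌋₊) - (x - ⌊x⌋₊) * (y - ⌊y⌋₊) else 0

theorem tent_of_nonpos {x : ℝ} (hx : x ≤ 0) : tent x = 0 :=
  max_eq_left ((min_le_left _ _).trans hx)

theorem tent_of_one_le {x : ℝ} (hx : 1 ≤ x) : tent x = 0 :=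
  max_eq_left ((min_le_right _ _).trans (by linarith))

theorem tent_of_le_half {x : ℝ} (hx : 0 ≤ x) (hx' : x ≤ 1 / 2) : tent x = x := by
  rw [tent, min_eq_left (by linarith), max_eq_right hx]

theorem tent_of_half_le {x : ℝ} (hx : 1 / 2 ≤ x) (hx' : x ≤ 1) : tent x = 1 - x := by
  rw [tent, min_eq_right (by linarith), max_eq_right (by linarith)]

theorem abs_tent_le_one (x : ℝ) : |tent x| ≤ 1 := by
  rw [tent, abs_of_nonneg (le_max_left _ _)]
  refine max_le zero_le_one ?_
  rcases le_total x 1 with h | h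
  · exact (min_le_left _ _).trans h
  · exact (min_le_right _ _).trans (by linarith)

theorem tent_sub_natCast_eq_zero {x : ℝ} (hx : 0 ≤ x) {k : ℕ} (hk : k ≠ ⌊x⌋₊) :
    tent (x - k) = 0 := by
  rcases hk.lt_or_gt with h | h
  · have hk' : (k : ℝ) + 1 ≤ x :=
      (by exact_mod_cast h : (k : ℝ) + 1 ≤ ⌊x⌋₊).trans (Nat.floor_le hx)
    exact tent_of_one_le (by linarith)
  · exact tent_of_nonpos (by linarith [(Nat.floor_lt hx).1 h])

theorem sum_tent_mul_tent {x : ℝ} (hx : 0 ≤ x) (y : ℝ) {m : ℕ} (hm : x < m) :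
    ∑ k ∈ Finset.range m, tent (x - k) * tent (y - k) =
      tent (x - ⌊x⌋₊) * tent (y - ⌊x⌋₊) :=
  Finset.sum_eq_single_of_mem _ (Finset.mem_range.2 ((Nat.floor_lt hx).2 hm)) fun k _ hk => by
    rw [tent_sub_natCast_eq_zero hx hk, zero_mul]

theorem two_pow_mul_mono {t : ℝ} (ht : 0 ≤ t) : Monotone fun n : ℕ => (2 : ℝ) ^ n * t :=
  fun _ _ h => mul_le_mul_of_nonneg_right (pow_le_pow_right₀ one_le_two h) ht

theorem continuous_schauder (n k : ℕ) : Continuous (schauder n k) := by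
  cases n with
  | zero => unfold schauder; fun_prop
  | succ n => unfold schauder tent; fun_prop

theorem schauder_zero_of_le {k : ℕ} {t : ℝ} (h : t ≤ k) : schauder 0 k t = 0 :=
  max_eq_left ((min_le_right _ _).trans (sub_nonpos.2 h))

theorem schauder_zero_of_mem {k : ℕ} {t : ℝ} (h : (k : ℝ) ≤ t) (h' : t ≤ k + 1) :
    schauder 0 k t = t - k := by
  rw [schauder, min_eq_right (by linarith), max_eq_right (by linarith)]

theorem schauder_zero_of_add_one_le {k : ℕ} {t : ℝ} (h : (k : ℝ) + 1 ≤ t) :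
    schauder 0 k t = 1 := by
  rw [schauder, min_eq_left (by linarith), max_eq_right zero_le_one]

theorem schauder_eq_zero {n k : ℕ} {t : ℝ} (ht : 0 ≤ t) (h : 2 ^ n * t ≤ k) :
    schauder n k t = 0 := by
  cases n with
  | zero => exact schauder_zero_of_le (by linarith)
  | succ n =>
    have hle : (2 : ℝ) ^ n * t ≤ 2 ^ (n + 1) * t := two_pow_mul_mono ht n.le_succ
    rw [schauder, tent_of_nonpos (by linarith), mul_zero]

theorem bridgeCov_comm (x y : ℝ) : bridgeCov x y = bridgeCov y x := by
  simp only [bridgeCov, eq_comm, min_comm, mul_comm]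

theorem bridgeCov_of_floor_eq {x y : ℝ} (h : ⌊x⌋₊ = ⌊y⌋₊) (hxy : x ≤ y) :
    bridgeCov x y = (x - ⌊x⌋₊) * (1 - (y - ⌊x⌋₊)) := by
  rw [bridgeCov, if_pos h, ← h, min_eq_left (by linarith)]
  ring

theorem bridgeCov_of_floor_ne {x y : ℝ} (h : ⌊x⌋₊ ≠ ⌊y⌋₊) : bridgeCov x y = 0 :=
  if_neg h

theorem abs_bridgeCov_le_one {x y : ℝ} (hx : 0 ≤ x) (hy : 0 ≤ y) : |bridgeCov x y| ≤ 1 := by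
  wlog hxy : x ≤ y generalizing x y
  · exact bridgeCov_comm x y ▸ this hy hx (le_of_not_ge hxy)
  by_cases h : ⌊x⌋₊ = ⌊y⌋₊
  · have hy' := h ▸ Nat.lt_floor_add_one y
    have hx' := Nat.floor_le hx
    rw [bridgeCov_of_floor_eq h hxy, abs_of_nonneg (mul_nonneg (by linarith) (by linarith))]
    exact mul_le_one₀ (by linarith) (by linarith) (by linarith)
  · rw [bridgeCov_of_floor_ne h, abs_zero]
    exact zero_le_one

theorem floor_two_mul {x : ℝ} (hx : 0 ≤ x) :
    (⌊2 * x⌋₊ = 2 * ⌊x⌋₊ ∧ x - ⌊x⌋₊ ≤ 1 / 2) ∨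
      (⌊2 * x⌋₊ = 2 * ⌊x⌋₊ + 1 ∧ 1 / 2 ≤ x - ⌊x⌋₊) := by
  have hle := Nat.floor_le hx
  have hlt := Nat.lt_floor_add_one x
  rcases lt_or_ge (x - ⌊x⌋₊) (1 / 2) with h | h
  · refine Or.inl ⟨(Nat.floor_eq_iff (by positivity)).2 ⟨?_, ?_⟩, h.le⟩ <;> push_cast <;> linarith
  · refine Or.inr ⟨(Nat.floor_eq_iff (by positivity)).2 ⟨?_, ?_⟩, h⟩ <;> push_cast <;> linarith

theorem floor_two_mul_div_two (x : ℝ) : ⌊2 * x⌋₊ / 2 = ⌊x⌋₊ := by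
  rw [← Nat.floor_div_ofNat, mul_div_cancel_left₀ x two_ne_zero]

theorem bridgeCov_eq_add {x y : ℝ} (hx : 0 ≤ x) (hxy : x ≤ y) :
    bridgeCov x y =
      tent (x - ⌊x⌋₊) * tent (y - ⌊x⌋₊) + 1 / 2 * bridgeCov (2 * x) (2 * y) := by
  have hy := hx.trans hxy
  by_cases h : ⌊x⌋₊ = ⌊y⌋₊
  · have hx' := Nat.floor_le hx
    have hy' := h ▸ Nat.lt_floor_add_one y
    have hxy' : 2 * x ≤ 2 * y := by linarith
    rw [bridgeCov_of_floor_eq h hxy]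
    rcases floor_two_mul hx with ⟨hfx, hax⟩ | ⟨hfx, hax⟩ <;>
      rcases floor_two_mul hy with ⟨hfy, hay⟩ | ⟨hfy, hay⟩ <;> rw [← h] at hfy hay
    · rw [bridgeCov_of_floor_eq (hfx.trans hfy.symm) hxy', hfx,
        tent_of_le_half (by linarith) hax, tent_of_le_half (by linarith) hay]
      push_cast
      ring
    · rw [bridgeCov_of_floor_ne (by lia), tent_of_le_half (by linarith) hax,
        tent_of_half_le hay (by linarith)]
      ring
    · exact absurd (Nat.floor_mono hxy') (by lia)
    · rw [bridgeCov_of_floor_eq (hfx.trans hfy.symm) hxy', hfx,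
        tent_of_half_le hax (by linarith), tent_of_half_le hay (by linarith)]
      push_cast
      ring
  · have h' : ⌊2 * x⌋₊ ≠ ⌊2 * y⌋₊ := fun h' =>
      h (by rw [← floor_two_mul_div_two x, h', floor_two_mul_div_two])
    rw [bridgeCov_of_floor_ne h, bridgeCov_of_floor_ne h', tent_sub_natCast_eq_zero hy h]
    ring

theorem sub_floor_mul_schauder_zero {s t : ℝ} (hs : 0 ≤ s) (hst : s ≤ t) :
    (s - ⌊s⌋₊) * schauder 0 ⌊s⌋₊ t = s - ⌊s⌋₊ - bridgeCov s t := by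
  by_cases h : ⌊s⌋₊ = ⌊t⌋₊
  · rw [bridgeCov_of_floor_eq h hst, schauder_zero_of_mem ((Nat.floor_le hs).trans hst)
      (h ▸ (Nat.lt_floor_add_one t).le)]
    ring
  · have hlt : (⌊s⌋₊ : ℝ) + 1 ≤ ⌊t⌋₊ := by
      exact_mod_cast lt_of_le_of_ne (Nat.floor_mono hst) h
    rw [bridgeCov_of_floor_ne h,
      schauder_zero_of_add_one_le (hlt.trans (Nat.floor_le (hs.trans hst)))]
    ring

theorem sum_schauder_zero_mul {s t : ℝ} (hs : 0 ≤ s) (hst : s ≤ t) {m : ℕ} (hm : s < m) :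
    ∑ k ∈ Finset.range m, schauder 0 k s * schauder 0 k t = s - bridgeCov s t := by
  have hbelow : ∀ k ∈ Finset.range ⌊s⌋₊, schauder 0 k s * schauder 0 k t = 1 := by
    intro k hk
    have hks : (k : ℝ) + 1 ≤ s :=
      (by exact_mod_cast Finset.mem_range.1 hk : (k : ℝ) + 1 ≤ ⌊s⌋₊).trans (Nat.floor_le hs)
    rw [schauder_zero_of_add_one_le hks, schauder_zero_of_add_one_le (hks.trans hst), one_mul]
  have habove : ∀ k ∈ Finset.range m, k ∉ Finset.range (⌊s⌋₊ + 1) →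
      schauder 0 k s * schauder 0 k t = 0 := by
    intro k _ hk
    have hsk : s ≤ k := ((Nat.floor_lt hs).1 (by simpa [Nat.succ_le_iff] using hk)).le
    rw [schauder_zero_of_le hsk, zero_mul]
  rw [← Finset.sum_subset (Finset.range_mono ((Nat.floor_lt hs).2 hm)) habove,
    Finset.sum_range_succ, Finset.sum_congr rfl hbelow,
    schauder_zero_of_mem (Nat.floor_le hs) (Nat.lt_floor_add_one s).le,
    sub_floor_mul_schauder_zero hs hst, Finset.sum_const, Finset.card_range, nsmul_one]
  ring

theorem sum_schauder_succ_mul (n m : ℕ) (s t : ℝ) :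
    ∑ k ∈ Finset.range m, schauder (n + 1) k s * schauder (n + 1) k t =
      (1 / 2) ^ n * ∑ k ∈ Finset.range m, tent (2 ^ n * s - k) * tent (2 ^ n * t - k) := by
  have hscale : (√2 ^ n)⁻¹ * (√2 ^ n)⁻¹ = (1 / 2 : ℝ) ^ n := by
    rw [← mul_inv, ← mul_pow, Real.mul_self_sqrt zero_le_two, one_div, inv_pow]
  rw [← hscale, Finset.mul_sum]
  exact Finset.sum_congr rfl fun k _ => mul_mul_mul_comm _ _ _ _

theorem sum_sum_schauder_mul_of_le {s t : ℝ} (hs : 0 ≤ s) (hst : s ≤ t) (n : ℕ) {m : ℕ}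
    (hm : 2 ^ n * s < m) :
    ∑ i ∈ Finset.range (n + 1), ∑ k ∈ Finset.range m, schauder i k s * schauder i k t =
      s - (1 / 2) ^ n * bridgeCov (2 ^ n * s) (2 ^ n * t) := by
  induction n with
  | zero =>
    rw [zero_add, Finset.sum_range_one, sum_schauder_zero_mul hs hst (by simpa using hm)]
    simp only [pow_zero, one_mul]
  | succ n ih =>
    have hm' : 2 ^ n * s < m := (two_pow_mul_mono hs n.le_succ).trans_lt hm
    rw [Finset.sum_range_succ, ih hm', sum_schauder_succ_mul,
      sum_tent_mul_tent (by positivity) _ hm',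
      bridgeCov_eq_add (by positivity) (by gcongr : 2 ^ n * s ≤ 2 ^ n * t),
      ← mul_assoc 2 _ s, ← mul_assoc 2 _ t, ← pow_succ' 2 n, pow_succ (1 / 2 : ℝ) n]
    ring

theorem sum_schauder_mul {s t : ℝ} (hs : 0 ≤ s) (ht : 0 ≤ t) (n : ℕ) {m : ℕ}
    (hsm : 2 ^ n * s < m) (htm : 2 ^ n * t < m) :
    ∑ p ∈ Finset.range (n + 1) ×ˢ Finset.range m, schauder p.1 p.2 s * schauder p.1 p.2 t =
      min s t - (1 / 2) ^ n * bridgeCov (2 ^ n * s) (2 ^ n * t) := by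
  rw [Finset.sum_product]
  rcases le_total s t with h | h
  · rw [sum_sum_schauder_mul_of_le hs h n hsm, min_eq_left h]
  · simp only [mul_comm (schauder _ _ s)]
    rw [sum_sum_schauder_mul_of_le ht h n htm, min_eq_right h, bridgeCov_comm]

theorem tendsto_bridgeCov {s t : ℝ} (hs : 0 ≤ s) (ht : 0 ≤ t) :
    Tendsto (fun n : ℕ => (1 / 2 : ℝ) ^ n * bridgeCov (2 ^ n * s) (2 ^ n * t)) atTop (𝓝 0) := by
  refine squeeze_zero_norm (fun n => ?_) (tendsto_pow_atTop_nhds_zero_of_lt_one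
    (r := (1 / 2 : ℝ)) (by norm_num) (by norm_num))
  rw [norm_mul, Real.norm_of_nonneg (by positivity : (0 : ℝ) ≤ (1 / 2) ^ n)]
  exact mul_le_of_le_one_right (by positivity)
    (abs_bridgeCov_le_one (by positivity) (by positivity))

end Schauder

section LevyConstruction

/-- The law of a family of independent standard Gaussian variables. -/
noncomputable def gaussianNoise (ι : Type*) : Measure (ι → ℝ) :=
  Measure.infinitePi fun _ => gaussianReal 0 1

instance (ι : Type*) : IsProbabilityMeasure (gaussianNoise ι) :=
  inferInstanceAs (IsProbabilityMeasure (Measure.infinitePi _))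

theorem charFun_map_mul_gaussianNoise {ι : Type*} (i : ι) (c s : ℝ) :
    charFun ((gaussianNoise ι).map fun ω => c * ω i) s =
      Complex.exp ((-((c * s) ^ 2) / 2 : ℝ)) := by
  have hlaw : (gaussianNoise ι).map (fun ω => ω i) = gaussianReal 0 1 :=
    Measure.infinitePi_map_eval _ i
  have hmap : (gaussianNoise ι).map (fun ω => c * ω i) =
      gaussianReal (c * 0) (.mk (c ^ 2) (sq_nonneg c) * 1) := by
    rw [← gaussianReal_map_const_mul, ← hlaw, Measure.map_map (by fun_prop) (by fun_prop)]
    rfl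
  rw [hmap, charFun_gaussianReal]
  congr 1
  push_cast
  ring

theorem integral_cexp_sum_gaussianNoise {ι : Type*} (S : Finset ι) (c : ι → ℝ) :
    ∫ ω, Complex.exp ((∑ i ∈ S, c i * ω i : ℝ) * Complex.I) ∂gaussianNoise ι =
      Complex.exp ((-(∑ i ∈ S, c i ^ 2) / 2 : ℝ)) := by
  have hindep : iIndepFun (fun (i : ι) (ω : ι → ℝ) => c i * ω i) (gaussianNoise ι) :=
    iIndepFun_infinitePi (X := fun i x => c i * x) fun i => by fun_prop
  have hsum : Measurable fun ω : ι → ℝ => ∑ i ∈ S, c i * ω i := by fun_prop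
  have h := congrFun ((hindep.restrict S).charFun_map_fun_finsetSum_eq_prod
    fun i _ => (by fun_prop : Measurable fun ω : ι → ℝ => c i * ω i).aemeasurable) 1
  rw [charFun_apply_real, integral_map hsum.aemeasurable (by fun_prop), Finset.prod_apply] at h
  simpa only [charFun_map_mul_gaussianNoise, ← Complex.exp_sum, ← Complex.ofReal_sum,
    ← Finset.sum_div, Finset.sum_neg_distrib, mul_one, Complex.ofReal_one, one_mul] using h

theorem ae_exists_forall_mul_le {Ω ι : Type*} [MeasurableSpace Ω] {μ : Measure Ω} [Countable ι]
    {f : ι → Ω → ℝ} (hf : ∀ i, Measurable (f i)) (hf0 : ∀ i ω, 0 ≤ f i ω) {M : ENNReal}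
    (hM : M ≠ ⊤) (hfM : ∀ i, ∫⁻ ω, ENNReal.ofReal (f i ω) ∂μ ≤ M) {w : ι → ℝ}
    (hw : Summable w) : ∀ᵐ ω ∂μ, ∃ C : ℝ, 0 ≤ C ∧ ∀ i, f i ω * w i ≤ C := by
  have hfin : ∫⁻ ω, ∑' i, ENNReal.ofReal (f i ω * w i) ∂μ ≠ ⊤ := by
    refine ne_top_of_le_ne_top (ENNReal.mul_ne_top hM hw.tsum_ofReal_ne_top) ?_
    rw [lintegral_tsum fun i => by fun_prop, ← ENNReal.tsum_mul_left]
    refine ENNReal.tsum_le_tsum fun i => ?_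
    simp_rw [ENNReal.ofReal_mul (hf0 i _)]
    rw [lintegral_mul_const _ (by fun_prop)]
    gcongr
    exact hfM i
  filter_upwards [ae_lt_top (Measurable.tsum fun i => by fun_prop) hfin] with ω hω
  refine ⟨(∑' i, ENNReal.ofReal (f i ω * w i)).toReal, ENNReal.toReal_nonneg, fun i => ?_⟩
  exact (ENNReal.ofReal_le_iff_le_toReal hω.ne).1 (ENNReal.le_tsum i)

theorem lintegral_pow_gaussianReal_ne_top {p : ℕ} (hp : Even p) :
    ∫⁻ x, ENNReal.ofReal (x ^ p) ∂gaussianReal 0 1 ≠ ⊤ := by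
  have hint := (memLp_id_gaussianReal (μ := 0) (v := 1) p).integrable_norm_pow'
  simp only [id_eq, Real.norm_eq_abs, hp.pow_abs] at hint
  exact hint.lintegral_lt_top.ne

theorem summable_half_pow_mul_one_div_sq :
    Summable fun i : ℕ × ℕ => (1 / 2 : ℝ) ^ i.1 * (1 / ((i.2 : ℝ) + 1) ^ 2) := by
  refine summable_geometric_two.mul_of_nonneg (g := fun k : ℕ => 1 / ((k : ℝ) + 1) ^ 2)
    ?_ (fun _ => by positivity) (fun _ => by positivity)
  exact_mod_cast (summable_nat_add_iff 1).2 (Real.summable_one_div_nat_pow.2 one_lt_two)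

-- The exponent `8` is even and larger than `6`: for `k ≤ 2 ^ n * K` the bound grows like
-- `2 ^ (3 * n)`, whose eighth root is beaten by the height `2 ^ (-n / 2)` of the tents of level
-- `n + 1`.
theorem ae_exists_pow_le : ∀ᵐ ω ∂gaussianNoise (ℕ × ℕ), ∃ C : ℝ, 0 ≤ C ∧ ∀ n k : ℕ,
    ω (n, k) ^ 8 ≤ C * (((k : ℝ) + 1) ^ 2 * 2 ^ n) := by
  have heven : Even 8 := by decide
  have hmoment (i : ℕ × ℕ) : ∫⁻ ω, ENNReal.ofReal (ω i ^ 8) ∂gaussianNoise (ℕ × ℕ) =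
      ∫⁻ x, ENNReal.ofReal (x ^ 8) ∂gaussianReal 0 1 :=
    (measurePreserving_eval_infinitePi (fun _ => gaussianReal 0 1) i).lintegral_comp
      (f := fun x => ENNReal.ofReal (x ^ 8)) (by fun_prop)
  filter_upwards [ae_exists_forall_mul_le (fun i => by fun_prop) (fun i ω => heven.pow_nonneg _)
    (lintegral_pow_gaussianReal_ne_top heven) (fun i => (hmoment i).le)
    summable_half_pow_mul_one_div_sq] with ω ⟨C, hC, hω⟩
  refine ⟨C, hC, fun n k => ?_⟩
  have h := hω (n, k)
  rwa [one_div_pow, one_div_mul_one_div, mul_one_div, div_le_iff₀ (by positivity),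
    mul_comm (2 ^ n)] at h

/-- The sum of the terms of level `n` in the Schauder expansion with coefficients `ω`. The range of
summation contains the indices of all the functions of this level that do not vanish at `t`. -/
noncomputable def levelSum (ω : ℕ × ℕ → ℝ) (n : ℕ) (t : ℝ≥0) : ℝ :=
  ∑ k ∈ Finset.range (⌊2 ^ n * (t : ℝ)⌋₊ + 1), ω (n, k) * schauder n k t

theorem levelSum_eq_sum_range (ω : ℕ × ℕ → ℝ) {n m : ℕ} {t : ℝ≥0} (hm : 2 ^ n * (t : ℝ) < m) :
    levelSum ω n t = ∑ k ∈ Finset.range m, ω (n, k) * schauder n k t := by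
  refine Finset.sum_subset (Finset.range_mono ((Nat.floor_lt (by positivity)).2 hm))
    fun k _ hk => ?_
  have hle : 2 ^ n * (t : ℝ) ≤ k :=
    ((Nat.floor_lt (by positivity)).1 (by simpa [Nat.succ_le_iff] using hk)).le
  rw [schauder_eq_zero t.coe_nonneg hle, mul_zero]

theorem levelSum_zero (ω : ℕ × ℕ → ℝ) (n : ℕ) : levelSum ω n 0 = 0 :=
  Finset.sum_eq_zero fun k _ => by rw [schauder_eq_zero (by simp) (by simp), mul_zero]

theorem continuous_levelSum (ω : ℕ × ℕ → ℝ) (n : ℕ) : Continuous (levelSum ω n) := by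
  refine continuous_iff_continuousAt.2 fun t₀ => ?_
  obtain ⟨m, hm⟩ := exists_nat_gt (2 ^ n * ((t₀ : ℝ) + 1))
  have hlocal : levelSum ω n =ᶠ[𝓝 t₀]
      fun t => ∑ k ∈ Finset.range m, ω (n, k) * schauder n k t := by
    filter_upwards [Iio_mem_nhds (lt_add_one t₀)] with t ht
    refine levelSum_eq_sum_range ω (lt_of_le_of_lt ?_ hm)
    gcongr
    exact_mod_cast (Set.mem_Iio.1 ht).le
  refine ContinuousAt.congr (Continuous.continuousAt ?_) hlocal.symm
  exact continuous_finsetSum _ fun k _ =>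
    continuous_const.mul ((continuous_schauder n k).comp NNReal.continuous_coe)

theorem measurable_levelSum (n : ℕ) (t : ℝ≥0) : Measurable fun ω => levelSum ω n t := by
  unfold levelSum
  fun_prop

theorem abs_levelSum_succ_le (ω : ℕ × ℕ → ℝ) (n : ℕ) (t : ℝ≥0) :
    |levelSum ω (n + 1) t| ≤ (√2 ^ n)⁻¹ * |ω (n + 1, ⌊2 ^ n * (t : ℝ)⌋₊)| := by
  have hmem : ⌊2 ^ n * (t : ℝ)⌋₊ ∈ Finset.range (⌊2 ^ (n + 1) * (t : ℝ)⌋₊ + 1) :=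
    Finset.mem_range_succ_iff.2 (Nat.floor_mono (two_pow_mul_mono t.coe_nonneg n.le_succ))
  have hsingle : levelSum ω (n + 1) t = ω (n + 1, ⌊2 ^ n * (t : ℝ)⌋₊) *
      ((√2 ^ n)⁻¹ * tent (2 ^ n * t - ⌊2 ^ n * (t : ℝ)⌋₊)) :=
    Finset.sum_eq_single_of_mem _ hmem fun k _ hk => by
      rw [schauder, tent_sub_natCast_eq_zero (by positivity) hk, mul_zero, mul_zero]
  rw [hsingle, abs_mul, abs_mul, abs_of_nonneg (by positivity : 0 ≤ (√2 ^ n)⁻¹), mul_left_comm]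
  gcongr
  exact mul_le_of_le_one_right (abs_nonneg _) (abs_tent_le_one _)

theorem inv_sqrt_two_pow_pow_eight (n : ℕ) : ((√2 ^ n)⁻¹) ^ 8 = ((1 / 2 : ℝ) ^ n) ^ 4 := by
  have hsq : ((√2)⁻¹ ^ 2) = (1 / 2 : ℝ) := by rw [inv_pow, Real.sq_sqrt zero_le_two, one_div]
  rw [← hsq, ← inv_pow]
  ring

theorem abs_levelSum_succ_pow_le {ω : ℕ × ℕ → ℝ} {C : ℝ} (hC : 0 ≤ C)
    (hω : ∀ n k : ℕ, ω (n, k) ^ 8 ≤ C * (((k : ℝ) + 1) ^ 2 * 2 ^ n)) {K t : ℝ≥0} (ht : t ≤ K)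
    (n : ℕ) :
    |levelSum ω (n + 1) t| ^ 8 ≤ 2 * C * ((K : ℝ) + 1) ^ 2 * (1 / 2) ^ n := by
  have hfloor : (⌊2 ^ n * (t : ℝ)⌋₊ : ℝ) + 1 ≤ 2 ^ n * (K + 1) := by
    have hle := Nat.floor_le (by positivity : 0 ≤ 2 ^ n * (t : ℝ))
    have hone : (1 : ℝ) ≤ 2 ^ n := one_le_pow₀ one_le_two
    have hmul : (2 : ℝ) ^ n * t ≤ 2 ^ n * K := by gcongr
    linarith
  have hcancel : (1 / 2 : ℝ) ^ n * 2 ^ n = 1 := by rw [← mul_pow]; norm_num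
  calc |levelSum ω (n + 1) t| ^ 8
      ≤ ((√2 ^ n)⁻¹ * |ω (n + 1, ⌊2 ^ n * (t : ℝ)⌋₊)|) ^ 8 := by
        gcongr
        exact abs_levelSum_succ_le ω n t
    _ = ((1 / 2 : ℝ) ^ n) ^ 4 * ω (n + 1, ⌊2 ^ n * (t : ℝ)⌋₊) ^ 8 := by
        rw [mul_pow, inv_sqrt_two_pow_pow_eight, Even.pow_abs (by decide)]
    _ ≤ ((1 / 2 : ℝ) ^ n) ^ 4 * (C * ((2 ^ n * (K + 1)) ^ 2 * 2 ^ (n + 1))) := by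
        gcongr
        exact (hω _ _).trans (by gcongr)
    _ = 2 * C * ((K : ℝ) + 1) ^ 2 * (1 / 2) ^ n * ((1 / 2 : ℝ) ^ n * 2 ^ n) ^ 3 := by ring
    _ = 2 * C * ((K : ℝ) + 1) ^ 2 * (1 / 2) ^ n := by rw [hcancel, one_pow, mul_one]

theorem ae_exists_summable_bound : ∀ᵐ ω ∂gaussianNoise (ℕ × ℕ), ∀ K : ℝ≥0, ∃ u : ℕ → ℝ,
    Summable u ∧ ∀ n, ∀ t ≤ K, |levelSum ω (n + 1) t| ≤ u n := by
  filter_upwards [ae_exists_pow_le] with ω ⟨C, hC, hω⟩ K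
  have hq : ((1 / 2 : ℝ) ^ (1 / 8 : ℝ)) < 1 :=
    Real.rpow_lt_one (by norm_num) (by norm_num) (by norm_num)
  refine ⟨fun n => (2 * C * ((K : ℝ) + 1) ^ 2) ^ (1 / 8 : ℝ) * ((1 / 2 : ℝ) ^ (1 / 8 : ℝ)) ^ n,
    (summable_geometric_of_lt_one (by positivity) hq).mul_left _, fun n t ht => ?_⟩
  refine (pow_le_pow_iff_left₀ (by positivity) (by positivity) (by norm_num : 8 ≠ 0)).1 ?_
  refine (abs_levelSum_succ_pow_le hC hω ht n).trans_eq ?_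
  have hroot {x : ℝ} (hx : 0 ≤ x) : (x ^ (1 / 8 : ℝ)) ^ 8 = x := by
    rw [← Real.rpow_mul_natCast hx]
    norm_num
  rw [mul_pow, pow_right_comm, hroot (by positivity), hroot (by positivity)]

/-- Lévy's construction of Brownian motion, from Gaussian coefficients. -/
noncomputable def levyProcess (t : ℝ≥0) (ω : ℕ × ℕ → ℝ) : ℝ :=
  levelSum ω 0 t + ∑' n, levelSum ω (n + 1) t

theorem levyProcess_zero (ω : ℕ × ℕ → ℝ) : levyProcess 0 ω = 0 := by
  simp only [levyProcess, levelSum_zero, tsum_zero, add_zero]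

theorem ae_continuous_levyProcess :
    ∀ᵐ ω ∂gaussianNoise (ℕ × ℕ), Continuous fun t => levyProcess t ω := by
  filter_upwards [ae_exists_summable_bound] with ω hω
  refine (continuous_levelSum ω 0).add (continuous_iff_continuousAt.2 fun t₀ => ?_)
  obtain ⟨u, hu, hbound⟩ := hω (t₀ + 1)
  have hcont : ContinuousOn (fun t => ∑' n, levelSum ω (n + 1) t) (Set.Iic (t₀ + 1)) :=
    continuousOn_tsum (fun n => (continuous_levelSum ω (n + 1)).continuousOn) hu
      fun n t ht => hbound n t ht
  exact hcont.continuousAt (Iic_mem_nhds (lt_add_one t₀))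

theorem ae_tendsto_levyProcess : ∀ᵐ ω ∂gaussianNoise (ℕ × ℕ), ∀ t,
    Tendsto (fun n => ∑ i ∈ Finset.range (n + 1), levelSum ω i t) atTop
      (𝓝 (levyProcess t ω)) := by
  filter_upwards [ae_exists_summable_bound] with ω hω t
  obtain ⟨u, hu, hbound⟩ := hω t
  have hsum : Summable fun n => levelSum ω (n + 1) t :=
    Summable.of_norm_bounded hu fun n => hbound n t le_rfl
  refine (hsum.hasSum.tendsto_sum_nat.const_add (levelSum ω 0 t)).congr fun n => ?_
  rw [Finset.sum_range_succ', add_comm]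

theorem aemeasurable_levyProcess (t : ℝ≥0) :
    AEMeasurable (levyProcess t) (gaussianNoise (ℕ × ℕ)) :=
  aemeasurable_of_tendsto_metrizable_ae atTop
    (fun n => (Finset.measurable_fun_sum (Finset.range (n + 1)) fun i _ =>
      measurable_levelSum i t).aemeasurable)
    (ae_tendsto_levyProcess.mono fun _ hω => hω t)

theorem sum_levelSum_eq (ω : ℕ × ℕ → ℝ) {n m : ℕ} {t : ℝ≥0} (hm : 2 ^ n * (t : ℝ) < m) :
    ∑ i ∈ Finset.range (n + 1), levelSum ω i t =
      ∑ p ∈ Finset.range (n + 1) ×ˢ Finset.range m, ω p * schauder p.1 p.2 t := by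
  rw [Finset.sum_product]
  refine Finset.sum_congr rfl fun i hi => levelSum_eq_sum_range ω (lt_of_le_of_lt ?_ hm)
  exact two_pow_mul_mono t.coe_nonneg (Finset.mem_range_succ_iff.1 hi)

theorem sum_sq_sum_mul {ι κ R : Type*} [CommSemiring R] (S : Finset κ) (T : Finset ι) (c : ι → R)
    (a : ι → κ → R) :
    ∑ p ∈ S, (∑ j ∈ T, c j * a j p) ^ 2 =
      ∑ j ∈ T, ∑ l ∈ T, c j * c l * ∑ p ∈ S, a j p * a l p := by
  simp only [sq, Finset.sum_mul_sum]
  rw [Finset.sum_comm]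
  refine Finset.sum_congr rfl fun j _ => ?_
  rw [Finset.sum_comm]
  refine Finset.sum_congr rfl fun l _ => ?_
  rw [Finset.mul_sum]
  exact Finset.sum_congr rfl fun p _ => mul_mul_mul_comm _ _ _ _

theorem integral_cexp_partial_levyProcess {ι : Type*} [Fintype ι] (t : ι → ℝ≥0) (c : ι → ℝ)
    (n : ℕ) :
    ∫ ω, Complex.exp ((∑ j, c j * ∑ i ∈ Finset.range (n + 1), levelSum ω i (t j) : ℝ) *
        Complex.I) ∂gaussianNoise (ℕ × ℕ) =
      Complex.exp ((-(∑ j, ∑ l, c j * c l * (min (t j : ℝ) (t l) -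
        (1 / 2) ^ n * bridgeCov (2 ^ n * t j) (2 ^ n * t l))) / 2 : ℝ)) := by
  obtain ⟨m, hm⟩ : ∃ m : ℕ, ∀ j, 2 ^ n * (t j : ℝ) < m := by
    obtain ⟨b, hb⟩ := Finite.bddAbove_range fun j => 2 ^ n * (t j : ℝ)
    obtain ⟨m, hm⟩ := exists_nat_gt b
    exact ⟨m, fun j => (hb ⟨j, rfl⟩).trans_lt hm⟩
  have hlinear (ω : ℕ × ℕ → ℝ) :
      ∑ j, c j * ∑ i ∈ Finset.range (n + 1), levelSum ω i (t j) =
        ∑ p ∈ Finset.range (n + 1) ×ˢ Finset.range m,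
          (∑ j, c j * schauder p.1 p.2 (t j)) * ω p := by
    simp only [sum_levelSum_eq ω (hm _), Finset.mul_sum, Finset.sum_mul]
    rw [Finset.sum_comm]
    exact Finset.sum_congr rfl fun p _ => Finset.sum_congr rfl fun j _ => by ring
  simp only [hlinear,
    integral_cexp_sum_gaussianNoise _ fun p : ℕ × ℕ => ∑ j, c j * schauder p.1 p.2 (t j),
    sum_sq_sum_mul _ _ c fun j (p : ℕ × ℕ) => schauder p.1 p.2 (t j),
    sum_schauder_mul (t _).coe_nonneg (t _).coe_nonneg n (hm _) (hm _)]

theorem integral_cexp_levyProcess {ι : Type*} [Fintype ι] (t : ι → ℝ≥0) (c : ι → ℝ) :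
    ∫ ω, Complex.exp ((∑ j, c j * levyProcess (t j) ω : ℝ) * Complex.I)
        ∂gaussianNoise (ℕ × ℕ) =
      Complex.exp ((-(∑ j, ∑ l, c j * c l * min (t j : ℝ) (t l)) / 2 : ℝ)) := by
  have hleft : Tendsto (fun n : ℕ => ∫ ω, Complex.exp
      ((∑ j, c j * ∑ i ∈ Finset.range (n + 1), levelSum ω i (t j) : ℝ) * Complex.I)
        ∂gaussianNoise (ℕ × ℕ)) atTop
      (𝓝 (∫ ω, Complex.exp ((∑ j, c j * levyProcess (t j) ω : ℝ) * Complex.I)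
        ∂gaussianNoise (ℕ × ℕ))) := by
    refine tendsto_integral_of_dominated_convergence (fun _ => 1) (fun n => ?_)
      (integrable_const _) (fun n => ae_of_all _ fun ω => ?_) ?_
    · have hmeas := measurable_levelSum
      exact Measurable.aestronglyMeasurable (by fun_prop)
    · rw [Complex.norm_exp_ofReal_mul_I]
    · filter_upwards [ae_tendsto_levyProcess] with ω hω
      have hcont : Continuous fun x : ℝ => Complex.exp (x * Complex.I) := by fun_prop
      exact (hcont.tendsto _).comp (tendsto_finsetSum _ fun j _ => (hω (t j)).const_mul (c j))
  have hright : Tendsto (fun n : ℕ => Complex.exp ((-(∑ j, ∑ l, c j * c l * (min (t j : ℝ) (t l) -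
      (1 / 2) ^ n * bridgeCov (2 ^ n * t j) (2 ^ n * t l))) / 2 : ℝ))) atTop
      (𝓝 (Complex.exp ((-(∑ j, ∑ l, c j * c l * min (t j : ℝ) (t l)) / 2 : ℝ)))) := by
    have hcont : Continuous fun x : ℝ => Complex.exp ((-x / 2 : ℝ)) := by fun_prop
    refine (hcont.tendsto _).comp (tendsto_finsetSum _ fun j _ => tendsto_finsetSum _ fun l _ =>
      Tendsto.const_mul _ ?_)
    simpa only [sub_zero] using
      (tendsto_bridgeCov (t j).coe_nonneg (t l).coe_nonneg).const_sub (min (t j : ℝ) (t l))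
  simp only [integral_cexp_partial_levyProcess] at hleft
  exact tendsto_nhds_unique hleft hright

theorem isPreBrownianReal_of_integral_cexp {Ω : Type*} [MeasurableSpace Ω] {P : Measure Ω}
    [IsFiniteMeasure P] {X : ℝ≥0 → Ω → ℝ} (hX : ∀ t, AEMeasurable (X t) P)
    (h : ∀ (I : Finset ℝ≥0) (c : I → ℝ),
      ∫ ω, Complex.exp ((∑ j, c j * X j ω : ℝ) * Complex.I) ∂P =
        Complex.exp ((-(∑ j : I, ∑ l : I, c j * c l * min ((j : ℝ≥0) : ℝ) (l : ℝ≥0)) / 2 : ℝ))) :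
    IsPreBrownianReal X P where
  hasLaw I := by
    have hmeas : AEMeasurable (fun ω => I.restrict (X · ω)) P :=
      aemeasurable_pi_lambda _ fun t => hX t
    refine ⟨hmeas, (MeasurableEquiv.toLp 2 (I → ℝ)).map_measurableEquiv_injective ?_⟩
    rw [MeasurableEquiv.coe_toLp,
      (BrownianReal.measurePreserving_toLp_projectiveFamily I).map_eq]
    refine Measure.ext_of_charFun (funext fun x => ?_)
    have hinner (ω : Ω) : inner ℝ (WithLp.toLp 2 (I.restrict (X · ω))) x = ∑ j, x j * X j ω :=
      PiLp.inner_apply _ _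
    have hcov : x ⬝ᵥ (BrownianReal.covMatrix I).mulVec x =
        ∑ j : I, ∑ l : I, x j * x l * min ((j : ℝ≥0) : ℝ) (l : ℝ≥0) := by
      simp only [dotProduct, Matrix.mulVec, Finset.mul_sum, BrownianReal.covMatrix_apply,
        NNReal.coe_min]
      exact Finset.sum_congr rfl fun j _ => Finset.sum_congr rfl fun l _ => by ring
    rw [charFun_multivariateGaussian (BrownianReal.posSemidef_covMatrix I), charFun_apply,
      integral_map (by fun_prop) (by fun_prop), integral_map hmeas (by fun_prop)]
    simp only [hinner, h I fun j => x j, inner_zero_right, Complex.ofReal_zero, zero_mul, zero_sub,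
      hcov]
    push_cast
    rw [neg_div]

theorem isBrownianReal_levyProcess : IsBrownianReal levyProcess (gaussianNoise (ℕ × ℕ)) where
  toIsPreBrownianReal := isPreBrownianReal_of_integral_cexp aemeasurable_levyProcess
    fun I c => integral_cexp_levyProcess (fun j : I => (j : ℝ≥0)) c
  cont := ae_continuous_levyProcess

end LevyConstruction

theorem mainTheorem4 :
    ∃ (Ω : Type) (_ : MeasurableSpace Ω) (P : Measure Ω) (_ : IsProbabilityMeasure P)
      (L : ℕ+ × ℝ≥0 → Ω → ℝ),
      IsBrownianReal (fun t => L (1, t)) P ∧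
      (∀ (r : ℕ+) (t : ℝ≥0) (ω : Ω), L (r, t) ω = scaledHermite r t (L (1, t) ω)) ∧
      (∀ p : FreeAlgebra ℂ (ℕ+ × ℝ≥0), Integrable (polyRandomVariable L p) P) ∧
      (∀ p : FreeAlgebra ℂ (ℕ+ × ℝ≥0),
        Tendsto
          (fun n : ℕ =>
            ncDistribution (canonicalTrace FinsetGroup)
              (fun i : ℕ+ × ℝ≥0 => setSum i.1 n i.2) p)
          atTop (𝓝 (classicalDistribution P L p))) := by
  have hB := isBrownianReal_levyProcess
  have hone (t : ℝ≥0) (ω : ℕ × ℕ → ℝ) :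
      scaledHermite ((1 : ℕ+) : ℕ) t (levyProcess t ω) = levyProcess t ω :=
    scaledHermite_one fun ht => ht ▸ levyProcess_zero ω
  let index (i : ℕ+ × ℝ≥0) : ℕ := i.1
  refine ⟨ℕ × ℕ → ℝ, inferInstance, gaussianNoise (ℕ × ℕ), inferInstance,
    fun i ω => scaledHermite (index i) i.2 (levyProcess i.2 ω), ?_, ?_, ?_, ?_⟩
  · simpa only [index, hone] using hB
  · exact fun r t ω => congrArg (scaledHermite r t) (hone t ω).symm
  · exact integrable_polyRandomVariable_scaledHermite index Prod.snd hB.toIsPreBrownianReal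
      levyProcess_zero
  · exact tendsto_ncDistribution_setSum index Prod.snd hB.toIsPreBrownianReal levyProcess_zero
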